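/- Let $R$ be a commutative Noetherian ring with identity, let $A$ be a projective Noetherian $R$-algebra (an $R$-algebra that is finitely generated and projective as an $R$-module), and let $\Lambda$ be a finite poset. Write $R\text{-proj}$ and $A\text{-proj}$ for the finitely generated projective $R$-modules and left $A$-modules, and $\operatorname{add} M$ for the class of modules isomorphic to direct summands of finite direct sums of copies of $M$. Let $DA_A=\operatorname{Hom}_R(A,R)$ be the dual of the right regular $A$-module, a left $A$-module via $(af)(x)=f(xa)$. A finitely generated left $A$-module that is projective over $R$ is called $(A,R)$-injective if it lies in $\operatorname{add} DA_A$. For a family of $A$-modules $\{X(\lambda)\}_{\lambda\in\Lambda}$, let $\mathcal F(\tilde X_{\mu>\lambda})$ be the class of finitely generated $A$-modules having a finite filtration whose factors are isomorphic to modules $X(\mu)\otimes_R U$ with $\mu>\lambda$ and $U\in R\text{-proj}$ (the zero module has the empty filtration). A family $\{\Delta(\lambda)\}_{\lambda\in\Lambda}$ of finitely generated left $A$-modules makes $A$ *split quasi-hereditary* if: each $\Delta(\lambda)$ is projective over $R$; $\operatorname{Hom}_A(\Delta(\lambda),\Delta(\mu))\neq 0$ implies $\lambda\le\mu$; $\operatorname{End}_A(\Delta(\lambda))\cong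 R$ as $R$-algebras for all $\lambda$; and there are $P(\lambda)\in A\text{-proj}$ and exact sequences $0\to C(\lambda)\to P(\lambda)\to\Delta(\lambda)\to 0$ with $C(\lambda)\in\mathcal F(\tilde\Delta_{\mu>\lambda})$ for all $\lambda \in \Lambda$, such that $\operatorname{add}\bigl(\bigoplus_{\lambda\in\Lambda}P(\lambda)\bigr)=A\text{-proj}$. **Theorem.** There exist modules $\{\Delta(\lambda)\}_{\lambda\in\Lambda}$ such that $(A,\{\Delta(\lambda)\}_{\lambda\in\Lambda})$ is split quasi-hereditary if and only if there exist left $A$-modules $\{\nabla(\lambda)\}_{\lambda\in\Lambda}$ with the following properties: (i) each $\nabla(\lambda)$ is finitely generated over $A$ and projective over $R$; (ii) for $\alpha,\beta\in\Lambda$, if $\operatorname{Hom}_A(\nabla(\alpha),\nabla(\beta))\ne 0$, then $\alpha\ge\beta$; (iii) $\operatorname{End}_A(\nabla(\lambda))\cong R$ as $R$-algebras for all $\lambda\in\Lambda$; (iv) for each $\lambda\in\Lambda$ there are an $(A,R)$-injective module $I(\lambda)$, projective over $R$, and an exact sequence of $A$-modules $0\to\nabla(\lambda)\to I(\lambda)\to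 K(\lambda)\to 0$ with $K(\lambda)\in\mathcal F(\tilde\nabla_{\mu>\lambda})$; (v) for these modules $I(\lambda)$, $DA_A\in\operatorname{add}\bigl(\bigoplus_{\lambda\in\Lambda} I(\lambda)\bigr)$. -/

import Mathlib

open scoped TensorProduct DirectSum

universe u v w

namespace SplitQH

/-- `N` lies in `add_A M`: it is a direct summand (retract) of a finite direct sum of
copies of `M`. -/
def InAdd (A : Type*) [Ring A] (M : Type*) [AddCommGroup M] [Module A M]
    (N : Type*) [AddCommGroup N] [Module A N] : Prop :=
  ∃ (n : ℕ) (i : N →ₗ[A] (Fin n → M)) (p : (Fin n → M) →ₗ[A] N), p ∘ₗ i = LinearMap.id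

/-- The `R`-dual `D A_A = Hom_R(A, R)` of the right regular `A`-module. -/
def RegularDual (R : Type*) (A : Type*) [CommRing R] [Ring A] [Algebra R A] : Type _ :=
  A →ₗ[R] R

namespace RegularDual

variable (R : Type*) (A : Type*) [CommRing R] [Ring A] [Algebra R A]

instance : AddCommGroup (RegularDual R A) :=
  inferInstanceAs (AddCommGroup (A →ₗ[R] R))

/-- The left `A`-action on `D A_A` induced by right multiplication: `(a • f) x = f (x * a)`. -/
instance : Module A (RegularDual R A) where
  smul a f := LinearMap.comp (R₁ := R) (R₂ := R) (R₃ := R) f (LinearMap.mulRight R a)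
  one_smul f := LinearMap.ext fun x => congrArg (DFunLike.coe (F := A →ₗ[R] R) f) (mul_one x)
  mul_smul a b f := LinearMap.ext fun x =>
    congrArg (DFunLike.coe (F := A →ₗ[R] R) f) (mul_assoc x a b).symm
  smul_zero _ := LinearMap.ext fun _ => rfl
  smul_add _ _ _ := LinearMap.ext fun _ => rfl
  add_smul a b f := LinearMap.ext fun x =>
    (congrArg (DFunLike.coe (F := A →ₗ[R] R) f) (mul_add x a b)).trans
      (map_add (F := A →ₗ[R] R) f _ _)
  zero_smul f := LinearMap.ext fun x =>
    (congrArg (DFunLike.coe (F := A →ₗ[R] R) f) (mul_zero x)).trans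
      (map_zero (F := A →ₗ[R] R) f)

end RegularDual

/-- `M` is a finitely generated `A`-module, projective over `R`, which is `(A, R)`-injective,
that is, `M ∈ add D A`. -/
def IsRelInjective (R : Type*) (A : Type*) [CommRing R] [Ring A] [Algebra R A]
    (M : Type*) [AddCommGroup M] [Module R M] [Module A M] : Prop :=
  Module.Finite A M ∧ Module.Projective R M ∧ InAdd A (RegularDual R A) M

/-- `M` has a finite filtration `0 = F 0 ≤ F 1 ≤ ⋯ ≤ F t = M` by `A`-submodules whose factors
are isomorphic to modules `X μ ⊗[R] U` with `μ ∈ S` and `U` a finitely generated projective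
`R`-module (`t = 0` is allowed and means `M = 0`). -/
def HasFiltration (R : Type u) (A : Type v) [CommRing R] [Ring A] [Algebra R A]
    {Λ : Type w} (X : Λ → Type*) [∀ l, AddCommGroup (X l)] [∀ l, Module R (X l)]
    [∀ l, Module A (X l)] [∀ l, IsScalarTower R A (X l)] (S : Set Λ)
    (M : Type*) [AddCommGroup M] [Module A M] : Prop :=
  ∃ (t : ℕ) (F : ℕ → Submodule A M), F 0 = ⊥ ∧ F t = ⊤ ∧ ∀ i < t, F i ≤ F (i + 1) ∧
    ∃ μ ∈ S, ∃ (U : Type u) (_ : AddCommGroup U) (_ : Module R U),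
      Module.Finite R U ∧ Module.Projective R U ∧
      Nonempty ((F (i + 1) ⧸ (F i).submoduleOf (F (i + 1))) ≃ₗ[A] (X μ ⊗[R] U))

/-- `(A, {Δ(l)})` is a split quasi-hereditary `R`-algebra. -/
structure IsSplitQuasiHereditary (R : Type u) (A : Type v) [CommRing R] [Ring A] [Algebra R A]
    {Λ : Type w} [PartialOrder Λ] (Δ : Λ → Type (max u v)) [∀ l, AddCommGroup (Δ l)]
    [∀ l, Module R (Δ l)] [∀ l, Module A (Δ l)] [∀ l, IsScalarTower R A (Δ l)] : Prop where
  finite_projective : ∀ l, Module.Finite A (Δ l) ∧ Module.Projective R (Δ l)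
  le_of_hom_ne_zero : ∀ l m, (∃ f : Δ l →ₗ[A] Δ m, f ≠ 0) → l ≤ m
  end_equiv : ∀ l, Nonempty (Module.End A (Δ l) ≃ₐ[R] R)
  /-- The projective modules `P(l)`, the exact sequences `0 → C(l) → P(l) → Δ(l) → 0` with
  `C(l)` the kernel of `P(l) → Δ(l)`, and `add (⨁ P(l)) = A-proj`. -/
  exists_projectives :
    ∃ (P : Λ → Type (max u v)) (_ : ∀ l, AddCommGroup (P l)) (_ : ∀ l, Module A (P l)),
      (∀ l, Module.Finite A (P l) ∧ Module.Projective A (P l) ∧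
        ∃ π : P l →ₗ[A] Δ l, Function.Surjective π ∧
          HasFiltration R A Δ (Set.Ioi l) (LinearMap.ker π)) ∧
      ∀ (M : Type (max u v)) [AddCommGroup M] [Module A M],
        InAdd A (⨁ l, P l) M ↔ (Module.Finite A M ∧ Module.Projective A M)

end SplitQH

/-! Two operations are combined. The first is $R$-duality $D=\operatorname{Hom}_R(-,R)$ on modules
that are finitely generated and projective over $R$. It turns a standard system for $A$ into a
costandard system for $A^{op}$ and conversely: it reverses maps and keeps scalar endomorphisms,
exchanges summands of $A^n$ with summands of $(DA)^n$, and reverses filtrations whose factors are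
$R$-projective (`StdSystem.nonempty_costdSystem`, `CostdSystem.nonempty_stdSystem`). The second is
the symmetry of quasi-heredity: a standard system for $A$ yields one for $A^{op}$ with the same
order (`StdSystem.nonempty_opposite`). Doing both returns to $A$ and gives each implication.

The symmetry rests on traces. For an upper set $S$ let $\operatorname{tr}_S M$ be the sum of the
images of all maps $P(\kappa)\to M$ with $\kappa\in S$. The key fact is `inAdd_subQuot_trace`:
adding one element $\mu$ to $S$ enlarges $\operatorname{tr}_S A$ by a section
$N_\mu\in\operatorname{add}\Delta(\mu)$, so the traces form a heredity chain of two-sided ideals. It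
is proved by climbing along filtrations: an extension by a member of $\operatorname{add}\Delta(\nu)$
is compatible with traces (`mem_trace_of_exact`), and the extensions of sections that arise split
(`exists_section`).

The new projectives are $\operatorname{Hom}_A(P(l),A)$, and the new standard module is the quotient
by the maps with values in $\operatorname{tr}_{\{\kappa\not\le l\}}A$. Filtering
$\operatorname{Hom}_A(P(l),A)$ by the submodules $\operatorname{Hom}_A(P(l),\operatorname{tr}_S A)$
produces factors $\operatorname{Hom}_A(P(l),N_\mu)$. As the endomorphisms of $\Delta(\mu)$ are
scalars,
$\operatorname{Hom}_A(P(l),N_\mu)\cong\operatorname{Hom}_A(P(l),\Delta(\mu))\otimes_R\operatorname{Hom}_A(\Delta(\mu),N_\mu)$,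
and the last factor is the new standard module at $\mu$ (`inAdd_subQuot_homTrace`).

Throughout, factors $X(\mu)\otimes_R U$ are replaced by members of $\operatorname{add}X(\mu)$, which
every functor in sight preserves; scalar endomorphisms make the two notions agree
(`InAdd.exists_tensor_equiv`). -/

namespace SplitQH

set_option linter.unusedSectionVars false

/-! ### Retracts of finite direct sums. -/

section InAdd

variable {A : Type*} [Ring A] {M : Type*} [AddCommGroup M] [Module A M]
  {N : Type*} [AddCommGroup N] [Module A N]

theorem InAdd.of_sum_eq_id {ι : Type*} [Fintype ι] (i : ι → N →ₗ[A] M) (p : ι → M →ₗ[A] N)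
    (h : ∑ k, p k ∘ₗ i k = LinearMap.id) : InAdd A M N := by
  let e := Fintype.equivFin ι
  refine ⟨Fintype.card ι, LinearMap.pi fun k => i (e.symm k),
    ∑ k, p (e.symm k) ∘ₗ LinearMap.proj k, ?_⟩
  rw [← h]
  ext x
  simp only [LinearMap.comp_apply, LinearMap.sum_apply, LinearMap.proj_apply, LinearMap.pi_apply]
  exact e.symm.sum_comp (fun k => p k (i k x))

theorem InAdd.exists_sum_eq_id (h : InAdd A M N) :
    ∃ (n : ℕ) (i : Fin n → N →ₗ[A] M) (p : Fin n → M →ₗ[A] N),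
      ∀ x, ∑ k, p k (i k x) = x := by
  obtain ⟨n, i, p, h⟩ := h
  refine ⟨n, fun k => LinearMap.proj k ∘ₗ i, fun k => p ∘ₗ LinearMap.single A (fun _ => M) k,
    fun x => ?_⟩
  have h1 := LinearMap.congr_fun h x
  simp only [LinearMap.comp_apply, LinearMap.id_apply] at h1
  simp only [LinearMap.comp_apply, LinearMap.proj_apply]
  rw [← map_sum]
  conv_rhs => rw [← h1]
  congr 1
  exact Finset.univ_sum_single (i x)

theorem InAdd.of_family {ι : Type*} [Fintype ι] {Y : ι → Type*} [∀ a, AddCommGroup (Y a)]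
    [∀ a, Module A (Y a)] (hY : ∀ a, InAdd A M (Y a)) (i : ∀ a, N →ₗ[A] Y a)
    (p : ∀ a, Y a →ₗ[A] N) (h : ∀ x, ∑ a, p a (i a x) = x) : InAdd A M N := by
  choose n j q hq using fun a => (hY a).exists_sum_eq_id
  refine InAdd.of_sum_eq_id (ι := Σ a, Fin (n a)) (fun s => j s.1 s.2 ∘ₗ i s.1)
    (fun s => p s.1 ∘ₗ q s.1 s.2) ?_
  ext x
  simp only [LinearMap.sum_apply, LinearMap.comp_apply, LinearMap.id_apply, Fintype.sum_sigma]
  exact (Finset.sum_congr rfl fun a _ =>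
    (map_sum (p a) (fun k => q a k (j a k (i a x))) _).symm.trans (congrArg (p a) (hq a _))).trans
    (h x)

theorem InAdd.of_retract {N' : Type*} [AddCommGroup N'] [Module A N'] (hN : InAdd A M N)
    (i : N' →ₗ[A] N) (p : N →ₗ[A] N') (h : ∀ x, p (i x) = x) : InAdd A M N' :=
  InAdd.of_family (ι := Unit) (fun _ => hN) (fun _ => i) (fun _ => p) (by simpa using h)

theorem InAdd.of_equiv {N' : Type*} [AddCommGroup N'] [Module A N'] (hN : InAdd A M N)
    (e : N' ≃ₗ[A] N) : InAdd A M N' :=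
  hN.of_retract e.toLinearMap e.symm.toLinearMap (by simp)

variable (A M) in
theorem InAdd.refl : InAdd A M M :=
  InAdd.of_sum_eq_id (ι := Unit) (fun _ => LinearMap.id) (fun _ => LinearMap.id) (by simp)

theorem InAdd.of_subsingleton [Subsingleton N] : InAdd A M N :=
  InAdd.of_sum_eq_id (ι := Empty) (fun _ => 0) (fun _ => 0)
    (LinearMap.ext fun _ => Subsingleton.elim _ _)

theorem InAdd.trans {L : Type*} [AddCommGroup L] [Module A L] (hM : InAdd A L M)
    (hN : InAdd A M N) : InAdd A L N := by
  obtain ⟨n, i, p, h⟩ := hN.exists_sum_eq_id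
  exact InAdd.of_family (fun _ => hM) i p h

/-- The section splits $Z$ as $N\oplus\ker g$, with $x\mapsto x-s(g(x))$ the projection to the
kernel. -/
theorem InAdd.of_section {Z : Type*} [AddCommGroup Z] [Module A Z] (g : Z →ₗ[A] N)
    (s : N →ₗ[A] Z) (hs : ∀ x, g (s x) = x) (hN : InAdd A M N)
    (hK : InAdd A M (LinearMap.ker g)) : InAdd A M Z := by
  obtain ⟨n, i, p, h⟩ := hN.exists_sum_eq_id
  obtain ⟨m, j, q, h'⟩ := hK.exists_sum_eq_id
  let r : Z →ₗ[A] LinearMap.ker g :=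
    (LinearMap.id - s ∘ₗ g).codRestrict _ fun x => by simp [hs]
  refine InAdd.of_sum_eq_id (ι := Fin n ⊕ Fin m) (Sum.elim (fun k => i k ∘ₗ g)
    (fun k => j k ∘ₗ r)) (Sum.elim (fun k => s ∘ₗ p k)
    (fun k => (LinearMap.ker g).subtype ∘ₗ q k)) ?_
  ext x
  simp only [Fintype.sum_sum_type, LinearMap.add_apply, LinearMap.sum_apply, Sum.elim_inl,
    Sum.elim_inr, LinearMap.comp_apply, LinearMap.id_apply]
  simp only [← map_sum, h, h']
  simp [r]

theorem InAdd.finite [Module.Finite A M] (h : InAdd A M N) : Module.Finite A N := by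
  obtain ⟨n, i, p, h⟩ := h
  exact Module.Finite.of_surjective p fun x => ⟨i x, LinearMap.congr_fun h x⟩

theorem InAdd.projective [Module.Projective A M] (h : InAdd A M N) : Module.Projective A N := by
  obtain ⟨n, i, p, h⟩ := h
  let e := DirectSum.linearEquivFunOnFintype A (Fin n) (fun _ => M)
  refine Module.Projective.of_split (e.symm.toLinearMap ∘ₗ i)
    (p ∘ₗ e.toLinearMap) ?_
  ext x
  simpa using LinearMap.congr_fun h x

theorem inAdd_self_of_finite_projective [Module.Finite A N] [Module.Projective A N] :
    InAdd A A N := by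
  obtain ⟨n, f, g, _, _, h⟩ := Module.Finite.exists_comp_eq_id_of_projective A N
  exact ⟨n, g, f, h⟩

theorem InAdd.restrictScalars (R : Type*) [CommRing R] [Algebra R A] [Module R M]
    [IsScalarTower R A M] [Module R N] [IsScalarTower R A N] (h : InAdd A M N) : InAdd R M N := by
  obtain ⟨n, i, p, h⟩ := h
  exact ⟨n, i.restrictScalars R, p.restrictScalars R, LinearMap.ext fun x =>
    LinearMap.congr_fun h x⟩

theorem InAdd.hom_eq_zero {L : Type*} [AddCommGroup L] [Module A L] (h : InAdd A M N)
    (h0 : ∀ f : M →ₗ[A] L, f = 0) (f : N →ₗ[A] L) : f = 0 := by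
  obtain ⟨n, i, p, h⟩ := h.exists_sum_eq_id
  ext x
  rw [← h x, map_sum]
  exact Finset.sum_eq_zero fun k _ => LinearMap.congr_fun (h0 (f ∘ₗ p k)) (i k x)

theorem InAdd.hom_eq_zero' {L : Type*} [AddCommGroup L] [Module A L] (h : InAdd A M N)
    (h0 : ∀ f : L →ₗ[A] M, f = 0) (f : L →ₗ[A] N) : f = 0 := by
  obtain ⟨n, i, p, h⟩ := h.exists_sum_eq_id
  ext x
  rw [← h (f x)]
  exact Finset.sum_eq_zero fun k _ => by
    rw [show i k (f x) = 0 from LinearMap.congr_fun (h0 (i k ∘ₗ f)) x, map_zero]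

/-- `N` is a retract of a finite direct sum of members of the family `P`. -/
def InAddFamily (A : Type*) [Ring A] {Λ : Type*} (P : Λ → Type*) [∀ l, AddCommGroup (P l)]
    [∀ l, Module A (P l)] (N : Type*) [AddCommGroup N] [Module A N] : Prop :=
  ∃ (n : ℕ) (l : Fin n → Λ) (i : ∀ k, N →ₗ[A] P (l k)) (p : ∀ k, P (l k) →ₗ[A] N),
    ∀ x, ∑ k, p k (i k x) = x

theorem InAddFamily.of_fintype {Λ : Type*} {P : Λ → Type*} [∀ l, AddCommGroup (P l)]
    [∀ l, Module A (P l)] {ι : Type*} [Fintype ι] (l : ι → Λ) (i : ∀ k, N →ₗ[A] P (l k))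
    (p : ∀ k, P (l k) →ₗ[A] N) (h : ∀ x, ∑ k, p k (i k x) = x) : InAddFamily A P N := by
  let e := Fintype.equivFin ι
  exact ⟨Fintype.card ι, fun k => l (e.symm k), fun k => i (e.symm k), fun k => p (e.symm k),
    fun x => (e.symm.sum_comp (fun k => p k (i k x))).trans (h x)⟩

theorem InAddFamily.of_equiv {Λ : Type*} {P : Λ → Type*} [∀ l, AddCommGroup (P l)]
    [∀ l, Module A (P l)] {N' : Type*} [AddCommGroup N'] [Module A N']
    (h : InAddFamily A P N) (e : N' ≃ₗ[A] N) : InAddFamily A P N' := by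
  obtain ⟨n, l, i, p, h⟩ := h
  exact ⟨n, l, fun k => i k ∘ₗ e.toLinearMap, fun k => e.symm.toLinearMap ∘ₗ p k,
    fun x => by simp [← map_sum, h]⟩

theorem inAdd_directSum_iff {Λ : Type*} [Finite Λ] (P : Λ → Type*) [∀ l, AddCommGroup (P l)]
    [∀ l, Module A (P l)] : InAdd A (⨁ l, P l) N ↔ InAddFamily A P N := by
  classical
  have := Fintype.ofFinite Λ
  constructor
  · intro h
    obtain ⟨n, i, p, h⟩ := h.exists_sum_eq_id
    refine InAddFamily.of_fintype (ι := Fin n × Λ) Prod.snd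
      (fun k => DirectSum.component A Λ P k.2 ∘ₗ i k.1)
      (fun k => p k.1 ∘ₗ DirectSum.lof A Λ P k.2) fun x => ?_
    simp only [Fintype.sum_prod_type, LinearMap.comp_apply]
    conv_rhs => rw [← h x]
    refine Finset.sum_congr rfl fun k _ => ?_
    rw [← map_sum]
    congr 1
    refine DirectSum.ext_component A fun l => ?_
    simp [DirectSum.component.of, map_sum]
  · rintro ⟨n, l, i, p, h⟩
    refine InAdd.of_family (fun k => ?_) i p h
    exact (InAdd.refl A (⨁ l, P l)).of_retract (DirectSum.lof A Λ P (l k))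
      (DirectSum.component A Λ P (l k)) (fun x => by simp [DirectSum.component.lof_self])

end InAdd

/-! ### Filtrations with factors in `add (X μ)`. -/

section Filt

variable {A : Type*} [Ring A] {Λ : Type*} (X : Λ → Type*) [∀ l, AddCommGroup (X l)]
  [∀ l, Module A (X l)] (S : Set Λ) {M : Type*} [AddCommGroup M] [Module A M]
  {N : Type*} [AddCommGroup N] [Module A N]

/-- The subquotient `F' / F` of two submodules. -/
abbrev SubQuot (F F' : Submodule A M) : Type _ := F' ⧸ F.submoduleOf F'

theorem mem_submoduleOf {F F' : Submodule A M} {x : F'} :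
    x ∈ F.submoduleOf F' ↔ (x : M) ∈ F := Iff.rfl

/-- A surjection from `F'` with kernel `F` identifies the subquotient `F' / F`. -/
noncomputable def subQuotEquiv {F F' : Submodule A M} (q : F' →ₗ[A] N)
    (hq : Function.Surjective q) (hk : ∀ x : F', q x = 0 ↔ (x : M) ∈ F) :
    SubQuot F F' ≃ₗ[A] N :=
  (Submodule.quotEquivOfEq _ _ (by ext x; exact (hk x).symm)).trans
    (q.quotKerEquivOfSurjective hq)

/-- `F ≤ F'` and the factor `F' / F` lies in `add (X μ)` for some `μ ∈ S`. -/
def FiltStep (F F' : Submodule A M) : Prop :=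
  F ≤ F' ∧ ∃ μ ∈ S, InAdd A (X μ) (SubQuot F F')

variable (A M) in
/-- `M` has a finite filtration with factors in the categories `add (X μ)`, `μ ∈ S`. -/
def Filt : Prop :=
  Relation.ReflTransGen (FiltStep X S) (⊥ : Submodule A M) ⊤

variable {X S}

theorem FiltStep.of_surjective {F F' : Submodule A M} (hle : F ≤ F') {μ : Λ} (hμ : μ ∈ S)
    (hN : InAdd A (X μ) N) (q : F' →ₗ[A] N) (hq : Function.Surjective q)
    (hk : ∀ x : F', q x = 0 ↔ (x : M) ∈ F) : FiltStep X S F F' :=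
  ⟨hle, μ, hμ, hN.of_equiv (subQuotEquiv q hq hk)⟩

theorem FiltStep.map {F F' : Submodule A M} (h : FiltStep X S F F') (f : M →ₗ[A] N)
    (hf : Function.Injective f) : FiltStep X S (F.map f) (F'.map f) := by
  obtain ⟨hle, μ, hμ, h⟩ := h
  refine FiltStep.of_surjective (Submodule.map_mono hle) hμ h
    ((F.submoduleOf F').mkQ ∘ₗ (Submodule.equivMapOfInjective f hf F').symm.toLinearMap)
    ((Submodule.mkQ_surjective _).comp (LinearEquiv.surjective _)) fun x => ?_
  obtain ⟨y, rfl⟩ := (Submodule.equivMapOfInjective f hf F').surjective x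
  simp only [LinearMap.comp_apply, LinearEquiv.coe_coe, LinearEquiv.symm_apply_apply,
    Submodule.mkQ_apply, Submodule.Quotient.mk_eq_zero, Submodule.coe_equivMapOfInjective_apply,
    mem_submoduleOf]
  exact ⟨fun h => ⟨_, h, rfl⟩, fun ⟨z, hz, e⟩ => by rwa [← hf e]⟩

theorem FiltStep.comap {F F' : Submodule A M} (h : FiltStep X S F F') (f : N →ₗ[A] M)
    (hf : F' ≤ LinearMap.range f) : FiltStep X S (F.comap f) (F'.comap f) := by
  obtain ⟨hle, μ, hμ, h⟩ := h
  refine FiltStep.of_surjective (Submodule.comap_mono hle) hμ h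
    ((F.submoduleOf F').mkQ ∘ₗ f.restrict (p := F'.comap f) fun x hx => hx)
    ((Submodule.mkQ_surjective _).comp ?_) fun x => ?_
  · rintro ⟨y, hy⟩
    obtain ⟨x, rfl⟩ := hf hy
    exact ⟨⟨x, hy⟩, rfl⟩
  · simp [mem_submoduleOf]

theorem Filt.of_chain {K : Submodule A M}
    (h : Relation.ReflTransGen (FiltStep X S) ⊥ K) : Filt A X S K := by
  have key : ∀ F : Submodule A M, Relation.ReflTransGen (FiltStep X S) ⊥ F → F ≤ K →
      Relation.ReflTransGen (FiltStep X S) (⊥ : Submodule A K) (F.comap K.subtype) := by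
    intro F hF
    induction hF with
    | refl =>
      intro _
      rw [show (⊥ : Submodule A M).comap K.subtype = ⊥ from by ext; simp]
    | tail _ h ih =>
      intro hK
      exact (ih (h.1.trans hK)).tail (h.comap K.subtype (by simpa using hK))
  have := key K h le_rfl
  rwa [show K.comap K.subtype = ⊤ from by ext; simp] at this

theorem Filt.chain_range (h : Filt A X S M) (f : M →ₗ[A] N) (hf : Function.Injective f) :
    Relation.ReflTransGen (FiltStep X S) ⊥ (LinearMap.range f) := by
  have key : ∀ F : Submodule A M, Relation.ReflTransGen (FiltStep X S) ⊥ F →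
      Relation.ReflTransGen (FiltStep X S) ⊥ (F.map f) := by
    intro F hF
    induction hF with
    | refl => rw [Submodule.map_bot]
    | tail _ h ih => exact ih.tail (h.map f hf)
  have := key ⊤ h
  rwa [Submodule.map_top] at this

theorem Filt.of_equiv (h : Filt A X S M) (e : M ≃ₗ[A] N) : Filt A X S N := by
  have := h.chain_range e.toLinearMap e.injective
  rwa [LinearEquiv.range] at this

/-- A map that vanishes on one term of the filtration induces a map on the next factor, which is
zero because the factor is a summand of some $X(\mu)^n$. -/
theorem Filt.hom_eq_zero (h : Filt A X S M) (h0 : ∀ μ ∈ S, ∀ f : X μ →ₗ[A] N, f = 0)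
    (f : M →ₗ[A] N) : f = 0 := by
  have key : ∀ F : Submodule A M, Relation.ReflTransGen (FiltStep X S) ⊥ F →
      F ≤ LinearMap.ker f := by
    intro F hF
    induction hF with
    | refl => exact bot_le
    | @tail F F' _ hs ih =>
      obtain ⟨hle, μ, hμ, hX⟩ := hs
      have := hX.hom_eq_zero (h0 μ hμ) ((F.submoduleOf F').liftQ (f ∘ₗ F'.subtype)
        fun x hx => ih hx)
      intro x hx
      exact LinearMap.congr_fun this (Submodule.Quotient.mk ⟨x, hx⟩)
  exact LinearMap.ker_eq_top.1 (top_le_iff.1 (key ⊤ h))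

end Filt

/-! ### Scalar endomorphisms and tensor products with projective modules. -/

section Scalar

variable {R : Type u} {A : Type*} [CommRing R] [Ring A] [Algebra R A] {X : Type*}
  [AddCommGroup X] [Module R X] [Module A X] [IsScalarTower R A X]

/-- The inverse of an $R$-algebra isomorphism onto $R$ can only be the structure map, so an abstract
isomorphism says that every endomorphism is a unique scalar. -/
theorem nonempty_end_algEquiv_iff : Nonempty (Module.End A X ≃ₐ[R] R) ↔
    Function.Bijective (algebraMap R (Module.End A X)) := by
  constructor
  · rintro ⟨e⟩
    have : (algebraMap R (Module.End A X) : R → _) = e.symm := by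
      ext1 r
      rw [AlgEquiv.eq_symm_apply, AlgEquiv.commutes]
      rfl
    rw [this]
    exact e.symm.bijective
  · intro h
    exact ⟨(AlgEquiv.ofBijective (Algebra.ofId R _) h).symm⟩

/-- Tensor products `X ⊗ U` with `U` finitely generated projective lie in `add X`. -/
theorem inAdd_tensor (U : Type*) [AddCommGroup U] [Module R U] [Module.Finite R U]
    [Module.Projective R U] : InAdd A X (X ⊗[R] U) := by
  obtain ⟨n, i, p, h⟩ := (inAdd_self_of_finite_projective (A := R) (N := U)).exists_sum_eq_id
  refine InAdd.of_family (ι := Fin n) (Y := fun _ => X ⊗[R] R) (fun _ =>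
    (InAdd.refl A X).of_equiv (TensorProduct.AlgebraTensorModule.rid R A X))
    (fun k => TensorProduct.AlgebraTensorModule.map LinearMap.id (i k))
    (fun k => TensorProduct.AlgebraTensorModule.map LinearMap.id (p k)) fun x => ?_
  induction x with
  | zero => simp
  | add x y hx hy => simp only [map_add, Finset.sum_add_distrib, hx, hy]
  | tmul x y => simp [← TensorProduct.tmul_sum, h]

/-- If the endomorphisms of `X` are scalars, then the members of `add X` are tensor products. -/
theorem InAdd.exists_tensor_equiv {N : Type*} [AddCommGroup N] [Module A N]
    (hX : Function.Bijective (algebraMap R (Module.End A X))) (h : InAdd A X N) :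
    ∃ (U : Type u) (_ : AddCommGroup U) (_ : Module R U),
      Module.Finite R U ∧ Module.Projective R U ∧ Nonempty (N ≃ₗ[A] (X ⊗[R] U)) := by
  obtain ⟨n, i, p, h⟩ := h.exists_sum_eq_id
  -- The idempotent of $X^n$ that cuts out $N$ has entries in $\operatorname{End}_A(X)=R$, so it is
  -- a scalar matrix `r`. It is idempotent over $R$ because scalars act faithfully on $X$, and its
  -- image on $R^n$ is the required $U$.
  choose r hr using fun k l => hX.2 (i k ∘ₗ p l)
  have hr' : ∀ k l x, i k (p l x) = r k l • x := fun k l x => (LinearMap.congr_fun (hr k l) x).symm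
  let e : (Fin n → R) →ₗ[R] (Fin n → R) := Matrix.toLin' (Matrix.of r)
  have he : ∀ u, e (e u) = e u := by
    have : Matrix.of r * Matrix.of r = Matrix.of r := by
      ext k l
      refine hX.1 (LinearMap.ext fun x => ?_)
      simp only [Matrix.mul_apply, Matrix.of_apply, Module.algebraMap_end_apply]
      rw [← hr' k l, ← h (p l x), map_sum, Finset.sum_smul]
      exact Finset.sum_congr rfl fun m _ => by rw [hr', hr', smul_smul]
    intro u
    simp only [e, ← Matrix.toLin'_mul_apply, this]
  let U := LinearMap.range e
  let q : (Fin n → R) →ₗ[R] U := e.rangeRestrict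
  have hq : ∀ u : U, q u = u := by
    rintro ⟨_, u, rfl⟩
    exact Subtype.ext (he u)
  have hU : InAdd R (Fin n → R) U := (InAdd.refl R (Fin n → R)).of_retract U.subtype q hq
  have hqk : ∀ k, (q (Pi.single k 1) : Fin n → R) = fun l => r l k := fun k => by
    ext l
    simp [q, e, Matrix.toLin'_apply]
  let F : N →ₗ[A] X ⊗[R] U := ∑ k, TensorProduct.AlgebraTensorModule.map LinearMap.id
    (LinearMap.toSpanSingleton R U (q (Pi.single k 1))) ∘ₗ
      (TensorProduct.AlgebraTensorModule.rid R A X).symm.toLinearMap ∘ₗ i k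
  let G : X ⊗[R] U →ₗ[A] N := ∑ k, p k ∘ₗ
    (TensorProduct.AlgebraTensorModule.rid R A X).toLinearMap ∘ₗ
      TensorProduct.AlgebraTensorModule.map LinearMap.id (LinearMap.proj k ∘ₗ U.subtype)
  have hF : ∀ y, F y = ∑ k, i k y ⊗ₜ[R] q (Pi.single k 1) := fun y => by simp [F]
  have hG : ∀ x u, G (x ⊗ₜ u) = ∑ k, p k ((u : Fin n → R) k • x) := fun x u => by simp [G]
  refine ⟨U, inferInstance, inferInstance, hU.finite, hU.projective,
    ⟨LinearEquiv.ofLinearMap F G ?_ ?_⟩⟩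
  · refine LinearMap.ext fun x => ?_
    induction x with
    | zero => simp
    | add x y hx hy => simp only [map_add, hx, hy]
    | tmul x u =>
      have h1 : ∀ k, i k (G (x ⊗ₜ u)) = (u : Fin n → R) k • x := fun k => by
        have h2 : (u : Fin n → R) k = ∑ l, r k l * (u : Fin n → R) l := by
          conv_lhs => rw [← hq u]
          simp [q, e, Matrix.toLin'_apply, Matrix.mulVec, dotProduct]
        rw [hG, map_sum, h2, Finset.sum_smul]
        exact Finset.sum_congr rfl fun l _ => by rw [hr', smul_smul]
      simp only [LinearMap.comp_apply, LinearMap.id_apply, hF, h1]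
      simp only [TensorProduct.smul_tmul, ← TensorProduct.tmul_sum, ← map_smul, ← map_sum]
      congr 1
      have h3 : ∑ k, (u : Fin n → R) k • (Pi.single k 1 : Fin n → R) = u := by
        ext l
        simp [Finset.sum_apply, Pi.single_apply]
      rw [h3]
      exact hq u
  · ext y
    simp only [LinearMap.comp_apply, LinearMap.id_apply, hF, map_sum, hG, hqk]
    rw [Finset.sum_comm]
    conv_rhs => rw [← h y]
    refine Finset.sum_congr rfl fun k _ => ?_
    rw [← map_sum]
    congr 1
    conv_rhs => rw [← h y, map_sum]
    exact Finset.sum_congr rfl fun l _ => (hr' _ _ _).symm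

end Scalar

/-! ### Reformulation of both sides by filtrations in `add`. -/

section HasFiltration

variable {R : Type u} {A : Type v} [CommRing R] [Ring A] [Algebra R A] {Λ : Type w}
  {X : Λ → Type*} [∀ l, AddCommGroup (X l)] [∀ l, Module R (X l)] [∀ l, Module A (X l)]
  [∀ l, IsScalarTower R A (X l)] {S : Set Λ} {M : Type*} [AddCommGroup M] [Module A M]

theorem HasFiltration.filt (h : HasFiltration R A X S M) : Filt A X S M := by
  obtain ⟨t, F, h0, ht, h⟩ := h
  have key : ∀ i ≤ t, Relation.ReflTransGen (FiltStep X S) ⊥ (F i) := by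
    intro i
    induction i with
    | zero => exact fun _ => h0 ▸ .refl
    | succ i ih =>
      intro hi
      obtain ⟨hle, μ, hμ, U, _, _, _, _, ⟨e⟩⟩ := h i hi
      exact (ih (by omega)).tail ⟨hle, μ, hμ, (inAdd_tensor U).of_equiv e⟩
  have := key t le_rfl
  rwa [ht] at this

theorem Filt.hasFiltration (hX : ∀ l, Function.Bijective (algebraMap R (Module.End A (X l))))
    (h : Filt A X S M) : HasFiltration R A X S M := by
  have key : ∀ K : Submodule A M, Relation.ReflTransGen (FiltStep X S) ⊥ K →
      ∃ (t : ℕ) (F : ℕ → Submodule A M), F 0 = ⊥ ∧ F t = K ∧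
        ∀ i < t, FiltStep X S (F i) (F (i + 1)) := by
    intro K hK
    induction hK with
    | refl => exact ⟨0, fun _ => ⊥, rfl, rfl, fun i hi => absurd hi (by omega)⟩
    | @tail K K' _ hs ih =>
      obtain ⟨t, F, h0, ht, h⟩ := ih
      refine ⟨t + 1, fun i => if i ≤ t then F i else K', by simp [h0], by simp, fun i hi => ?_⟩
      rcases Nat.lt_succ_iff_lt_or_eq.1 hi with hi | rfl
      · simpa [hi.le, Nat.succ_le_of_lt hi] using h i hi
      · simpa [ht] using hs
  obtain ⟨t, F, h0, ht, hs⟩ := key ⊤ h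
  refine ⟨t, F, h0, ht, fun i hi => ?_⟩
  obtain ⟨hle, μ, hμ, hN⟩ := hs i hi
  exact ⟨hle, μ, hμ, hN.exists_tensor_equiv (hX μ)⟩

end HasFiltration

/-- Standard modules together with projective modules filtered by them. -/
structure StdSystem (R : Type u) (A : Type v) [CommRing R] [Ring A] [Algebra R A]
    (Λ : Type w) [PartialOrder Λ] where
  Δ : Λ → Type (max u v)
  [grpΔ : ∀ l, AddCommGroup (Δ l)]
  [baseΔ : ∀ l, Module R (Δ l)]
  [modΔ : ∀ l, Module A (Δ l)]
  [towerΔ : ∀ l, IsScalarTower R A (Δ l)]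
  [finiteΔ : ∀ l, Module.Finite R (Δ l)]
  [projΔ : ∀ l, Module.Projective R (Δ l)]
  P : Λ → Type (max u v)
  [grpP : ∀ l, AddCommGroup (P l)]
  [baseP : ∀ l, Module R (P l)]
  [modP : ∀ l, Module A (P l)]
  [towerP : ∀ l, IsScalarTower R A (P l)]
  [finiteP : ∀ l, Module.Finite A (P l)]
  [projP : ∀ l, Module.Projective A (P l)]
  hom_eq_zero : ∀ l m, ¬ l ≤ m → ∀ f : Δ l →ₗ[A] Δ m, f = 0
  end_bijective : ∀ l, Function.Bijective (algebraMap R (Module.End A (Δ l)))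
  π : ∀ l, P l →ₗ[A] Δ l
  π_surjective : ∀ l, Function.Surjective (π l)
  filt_ker : ∀ l, Filt A Δ (Set.Ioi l) (LinearMap.ker (π l))
  generates : InAddFamily A P A

attribute [instance] StdSystem.grpΔ StdSystem.baseΔ StdSystem.modΔ StdSystem.towerΔ
  StdSystem.finiteΔ StdSystem.projΔ StdSystem.grpP StdSystem.baseP StdSystem.modP
  StdSystem.towerP StdSystem.finiteP StdSystem.projP

/-- Costandard modules together with relatively injective modules cofiltered by them. -/
structure CostdSystem (R : Type u) (A : Type v) [CommRing R] [Ring A] [Algebra R A]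
    (Λ : Type w) [PartialOrder Λ] where
  N : Λ → Type (max u v)
  [grpN : ∀ l, AddCommGroup (N l)]
  [baseN : ∀ l, Module R (N l)]
  [modN : ∀ l, Module A (N l)]
  [towerN : ∀ l, IsScalarTower R A (N l)]
  [finiteN : ∀ l, Module.Finite R (N l)]
  [projN : ∀ l, Module.Projective R (N l)]
  I : Λ → Type (max u v)
  [grpI : ∀ l, AddCommGroup (I l)]
  [baseI : ∀ l, Module R (I l)]
  [modI : ∀ l, Module A (I l)]
  [towerI : ∀ l, IsScalarTower R A (I l)]
  [finiteI : ∀ l, Module.Finite R (I l)]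
  [projI : ∀ l, Module.Projective R (I l)]
  hom_eq_zero : ∀ l m, ¬ m ≤ l → ∀ f : N l →ₗ[A] N m, f = 0
  end_bijective : ∀ l, Function.Bijective (algebraMap R (Module.End A (N l)))
  inAdd_dual : ∀ l, InAdd A (RegularDual R A) (I l)
  ι : ∀ l, N l →ₗ[A] I l
  ι_injective : ∀ l, Function.Injective (ι l)
  filt_coker : ∀ l, Filt A N (Set.Ioi l) (I l ⧸ LinearMap.range (ι l))
  generates : InAddFamily A I (RegularDual R A)

attribute [instance] CostdSystem.grpN CostdSystem.baseN CostdSystem.modN CostdSystem.towerN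
  CostdSystem.finiteN CostdSystem.projN CostdSystem.grpI CostdSystem.baseI CostdSystem.modI
  CostdSystem.towerI CostdSystem.finiteI CostdSystem.projI

variable (R : Type u) [CommRing R] (A : Type v) [Ring A] [Algebra R A] [Module.Finite R A]
  (Λ : Type w) [PartialOrder Λ] [Finite Λ]

theorem exists_isSplitQuasiHereditary_iff :
    (∃ (Δ : Λ → Type (max u v)) (_ : ∀ l, AddCommGroup (Δ l)) (_ : ∀ l, Module R (Δ l))
        (_ : ∀ l, Module A (Δ l)) (_ : ∀ l, IsScalarTower R A (Δ l)),
        IsSplitQuasiHereditary R A Δ) ↔ Nonempty (StdSystem R A Λ) := by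
  constructor
  · rintro ⟨Δ, _, _, _, _, ⟨h1, h2, h3, P, _, _, h4, h5⟩⟩
    -- The projectives come only with an action of $A$; the base ring acts through the structure
    -- map.
    let : ∀ l, Module R (P l) := fun l => Module.compHom (P l) (algebraMap R A)
    have : ∀ l, IsScalarTower R A (P l) := fun l =>
      ⟨fun r a x => by rw [Algebra.smul_def, mul_smul]; rfl⟩
    have := fun l => (h1 l).1
    have : ∀ l, Module.Finite R (Δ l) := fun l => Module.Finite.trans A (Δ l)
    have := fun l => (h1 l).2
    have := fun l => (h4 l).1
    have := fun l => (h4 l).2.1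
    choose π hπ hf using fun l => (h4 l).2.2
    refine ⟨{
      Δ := Δ
      P := P
      hom_eq_zero := fun l m hlm f => by_contra fun hf => hlm (h2 l m ⟨f, hf⟩)
      end_bijective := fun l => nonempty_end_algEquiv_iff.1 (h3 l)
      π := π
      π_surjective := hπ
      filt_ker := fun l => (hf l).filt
      generates := ?_ }⟩
    -- The generation condition speaks of modules in `Type (max u v)`, whence the lift of the
    -- regular module. That $A$ itself is generated is all that has to be kept: every finitely
    -- generated projective module is a retract of some $A^n$.
    have := (h5 (ULift.{max u v} A)).2 ⟨inferInstance, inferInstance⟩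
    exact ((inAdd_directSum_iff P).1 this).of_equiv ULift.moduleEquiv.symm
  · rintro ⟨D⟩
    refine ⟨D.Δ, D.grpΔ, D.baseΔ, D.modΔ, D.towerΔ, ⟨fun l => ⟨?_, inferInstance⟩, ?_, ?_, ?_⟩⟩
    · exact Module.Finite.of_restrictScalars_finite R A (D.Δ l)
    · exact fun l m ⟨f, hf⟩ => by_contra fun h => hf (D.hom_eq_zero l m h f)
    · exact fun l => nonempty_end_algEquiv_iff.2 (D.end_bijective l)
    · refine ⟨D.P, D.grpP, D.modP, fun l => ⟨inferInstance, inferInstance, D.π l,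
        D.π_surjective l, (D.filt_ker l).hasFiltration D.end_bijective⟩, fun M _ _ => ⟨?_, ?_⟩⟩
      · intro h
        have : Module.Finite A (⨁ l, D.P l) := by
          classical
          have := Fintype.ofFinite Λ
          exact Module.Finite.equiv (DirectSum.linearEquivFunOnFintype A Λ D.P).symm
        exact ⟨h.finite, h.projective⟩
      · rintro ⟨_, _⟩
        exact ((inAdd_directSum_iff D.P).2 D.generates).trans inAdd_self_of_finite_projective

theorem nonempty_costdSystem_iff :
    Nonempty (CostdSystem R A Λ) ↔
    (∃ (N : Λ → Type (max u v)) (_ : ∀ l, AddCommGroup (N l)) (_ : ∀ l, Module R (N l))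
        (_ : ∀ l, Module A (N l)) (_ : ∀ l, IsScalarTower R A (N l)),
        (∀ l, Module.Finite A (N l) ∧ Module.Projective R (N l)) ∧
        (∀ a b, (∃ f : N a →ₗ[A] N b, f ≠ 0) → a ≥ b) ∧
        (∀ l, Nonempty (Module.End A (N l) ≃ₐ[R] R)) ∧
        ∃ (I : Λ → Type (max u v)) (_ : ∀ l, AddCommGroup (I l)) (_ : ∀ l, Module R (I l))
          (_ : ∀ l, Module A (I l)) (_ : ∀ l, IsScalarTower R A (I l)),
          (∀ l, SplitQH.IsRelInjective R A (I l) ∧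
            ∃ ι : N l →ₗ[A] I l, Function.Injective ι ∧
              SplitQH.HasFiltration R A N (Set.Ioi l) (I l ⧸ LinearMap.range ι)) ∧
          SplitQH.InAdd A (⨁ l, I l) (SplitQH.RegularDual R A)) := by
  constructor
  · rintro ⟨D⟩
    refine ⟨D.N, D.grpN, D.baseN, D.modN, D.towerN, fun l => ⟨?_, inferInstance⟩, ?_, ?_,
      D.I, D.grpI, D.baseI, D.modI, D.towerI, fun l => ⟨⟨?_, inferInstance, D.inAdd_dual l⟩,
        D.ι l, D.ι_injective l, (D.filt_coker l).hasFiltration D.end_bijective⟩,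
        (inAdd_directSum_iff D.I).2 D.generates⟩
    · exact Module.Finite.of_restrictScalars_finite R A (D.N l)
    · exact fun l m ⟨f, hf⟩ => by_contra fun h => hf (D.hom_eq_zero l m h f)
    · exact fun l => nonempty_end_algEquiv_iff.2 (D.end_bijective l)
    · exact Module.Finite.of_restrictScalars_finite R A (D.I l)
  · rintro ⟨N, _, _, _, _, h1, h2, h3, I, _, _, _, _, h4, h5⟩
    have := fun l => (h1 l).1
    have : ∀ l, Module.Finite R (N l) := fun l => Module.Finite.trans A (N l)
    have := fun l => (h1 l).2
    have := fun l => (h4 l).1.1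
    have : ∀ l, Module.Finite R (I l) := fun l => Module.Finite.trans A (I l)
    have := fun l => (h4 l).1.2.1
    choose ι hι hf using fun l => (h4 l).2
    exact ⟨{
      N := N
      I := I
      hom_eq_zero := fun l m hlm f => by_contra fun hf => hlm (h2 l m ⟨f, hf⟩)
      end_bijective := fun l => nonempty_end_algEquiv_iff.1 (h3 l)
      inAdd_dual := fun l => (h4 l).1.2.2
      ι := ι
      ι_injective := hι
      filt_coker := fun l => (hf l).filt
      generates := (inAdd_directSum_iff I).1 h5 }⟩

/-! ### Sequences that split over the base ring. -/

section Exactness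

variable {R : Type*} [Ring R] {K Z Q : Type*} [AddCommGroup K] [Module R K] [AddCommGroup Z]
  [Module R Z] [AddCommGroup Q] [Module R Q]

theorem exists_retraction [Module.Projective R Q] (f : K →ₗ[R] Z) (hf : Function.Injective f)
    (g : Z →ₗ[R] Q) (hg : Function.Surjective g) (h : Function.Exact f g) :
    ∃ r : Z →ₗ[R] K, ∀ x, r (f x) = x := by
  obtain ⟨s, hs⟩ := Module.projective_lifting_property g LinearMap.id hg
  have hs' : ∀ x, g (s x) = x := LinearMap.congr_fun hs
  let e := LinearEquiv.ofInjective f hf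
  have hr : ∀ x, (LinearMap.id - s ∘ₗ g : Z →ₗ[R] Z) x ∈ LinearMap.range f := fun x =>
    (h _).1 (by simp [hs'])
  refine ⟨e.symm.toLinearMap ∘ₗ (LinearMap.id - s ∘ₗ g).codRestrict _ hr, fun x => ?_⟩
  rw [LinearMap.comp_apply, LinearEquiv.coe_coe, LinearEquiv.symm_apply_eq]
  exact Subtype.ext (by simp [e, h.apply_apply_eq_zero])

theorem projective_of_exact [Module.Projective R K] [Module.Projective R Q] (f : K →ₗ[R] Z)
    (hf : Function.Injective f) (g : Z →ₗ[R] Q) (hg : Function.Surjective g)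
    (h : Function.Exact f g) : Module.Projective R Z := by
  obtain ⟨s, hs⟩ := Module.projective_lifting_property g LinearMap.id hg
  exact Module.Projective.of_equiv (h.splitSurjectiveEquiv hf ⟨s, hs⟩).1.symm

end Exactness

/-! ### Duality over the base ring. -/

/-- The `R`-linear map on a quotient by an `A`-submodule induced by an `R`-linear map. -/
noncomputable def liftBase {R A M N : Type*} [CommRing R] [Ring A] [Algebra R A]
    [AddCommGroup M] [Module R M] [Module A M] [IsScalarTower R A M] [AddCommGroup N] [Module R N]
    (P : Submodule A M) (f : M →ₗ[R] N) (h : ∀ x ∈ P, f x = 0) : (M ⧸ P) →ₗ[R] N :=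
  (P.restrictScalars R).liftQ f h ∘ₗ
    (Submodule.Quotient.restrictScalarsEquiv R P).symm.toLinearMap

/-- The `R`-dual of an `A`-module, as a module over an algebra `B` acting on `A` from the
right. -/
def RDual (R A B M : Type*) [CommRing R] [Ring A] [Algebra R A] [Ring B] [Algebra R B]
    [Module B A] [AddCommGroup M] [Module R M] [Module A M] : Type _ := M →ₗ[R] R

namespace RDual

variable {R A B : Type*} [CommRing R] [Ring A] [Algebra R A] [Ring B] [Algebra R B]
  [Module B A] {M : Type*} [AddCommGroup M] [Module R M] [Module A M]
  {M' : Type*} [AddCommGroup M'] [Module R M'] [Module A M']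

instance : AddCommGroup (RDual R A B M) := inferInstanceAs (AddCommGroup (M →ₗ[R] R))
instance : Module R (RDual R A B M) := inferInstanceAs (Module R (M →ₗ[R] R))
instance : FunLike (RDual R A B M) M R := inferInstanceAs (FunLike (M →ₗ[R] R) M R)
instance : LinearMapClass (RDual R A B M) R M R :=
  inferInstanceAs (LinearMapClass (M →ₗ[R] R) R M R)
instance [Module.Finite R M] [Module.Projective R M] : Module.Finite R (RDual R A B M) :=
  inferInstanceAs (Module.Finite R (Module.Dual R M))
instance [Module.Finite R M] [Module.Projective R M] : Module.Projective R (RDual R A B M) :=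
  inferInstanceAs (Module.Projective R (Module.Dual R M))

@[ext] theorem ext {f g : RDual R A B M} (h : ∀ x, f x = g x) : f = g := LinearMap.ext h

theorem add_apply (f g : RDual R A B M) (x : M) : (f + g) x = f x + g x := rfl
theorem base_smul_apply (r : R) (f : RDual R A B M) (x : M) : (r • f) x = r * f x := rfl
theorem sum_apply {ι : Type*} (s : Finset ι) (f : ι → RDual R A B M) (x : M) :
    (∑ k ∈ s, f k) x = ∑ k ∈ s, f k x :=
  LinearMap.sum_apply (σ₁₂ := RingHom.id R) s f x

variable [IsScalarTower R A M] [IsScalarTower R A M'] [SMulCommClass A B A] [IsScalarTower R B A]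

/-- The map $b\mapsto b\cdot 1$ reverses products; when it is bijective, $B$ is $A^{op}$. Keeping
$B$ abstract lets the same results serve the pairs $(A,A^{op})$ and $(A^{op},A)$ without a double
opposite. -/
theorem smul_one_mul_smul_one (b c : B) : (b • (1 : A)) * (c • (1 : A)) = (c * b) • (1 : A) := by
  have := SMulCommClass.symm A B A
  rw [mul_smul_comm, mul_one, mul_smul]

instance : Module B (RDual R A B M) where
  smul b f := f.comp (Algebra.lsmul R R M (b • (1 : A)))
  one_smul f := ext fun x => congrArg f (show ((1 : B) • (1 : A)) • x = x by simp)
  mul_smul b c f := ext fun x => congrArg f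
    (show ((b * c) • (1 : A)) • x = (c • (1 : A)) • (b • (1 : A)) • x by
      rw [smul_smul, smul_one_mul_smul_one])
  smul_zero _ := rfl
  smul_add _ _ _ := rfl
  add_smul b c f := ext fun x =>
    (congrArg f (show ((b + c) • (1 : A)) • x = (b • (1 : A)) • x + (c • (1 : A)) • x by
      rw [add_smul, add_smul])).trans (map_add f _ _)
  zero_smul f := ext fun x =>
    (congrArg f (show ((0 : B) • (1 : A)) • x = 0 by simp)).trans (map_zero f)

theorem smul_apply (b : B) (f : RDual R A B M) (x : M) : (b • f) x = f ((b • (1 : A)) • x) := rfl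

instance : IsScalarTower R B (RDual R A B M) where
  smul_assoc r b f := ext fun x => by
    rw [smul_apply, base_smul_apply, smul_apply, smul_assoc r b (1 : A),
      smul_assoc r (b • (1 : A)) x, map_smul, smul_eq_mul]

/-- The dual of a linear map. -/
def map (g : M →ₗ[A] M') : RDual R A B M' →ₗ[B] RDual R A B M where
  toFun f := LinearMap.comp f (g.restrictScalars R)
  map_add' _ _ := rfl
  map_smul' b f := ext fun x => congrArg f (map_smul g (b • (1 : A)) x).symm

theorem map_apply (g : M →ₗ[A] M') (f : RDual R A B M') (x : M) :
    map g f x = f (g x) := rfl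

theorem inAdd {L N : Type*} [AddCommGroup L] [Module R L] [Module A L] [IsScalarTower R A L]
    [AddCommGroup N] [Module R N] [Module A N] [IsScalarTower R A N] (h : InAdd A L N) :
    InAdd B (RDual R A B L) (RDual R A B N) := by
  obtain ⟨n, i, p, h⟩ := h.exists_sum_eq_id
  refine InAdd.of_sum_eq_id (fun k => map (p k)) (fun k => map (i k)) ?_
  refine LinearMap.ext fun f => ext fun x => ?_
  simp only [LinearMap.sum_apply, LinearMap.comp_apply, LinearMap.id_apply, sum_apply, map_apply]
  rw [← map_sum, h]

theorem inAddFamily {Λ : Type*} {P : Λ → Type*} {N : Type*} [∀ l, AddCommGroup (P l)]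
    [∀ l, Module R (P l)] [∀ l, Module A (P l)] [∀ l, IsScalarTower R A (P l)]
    [AddCommGroup N] [Module R N] [Module A N] [IsScalarTower R A N] (h : InAddFamily A P N) :
    InAddFamily B (fun l => RDual R A B (P l)) (RDual R A B N) := by
  obtain ⟨n, l, i, p, h⟩ := h
  refine ⟨n, l, fun k => map (p k), fun k => map (i k), fun f => ext fun x => ?_⟩
  simp only [sum_apply, map_apply]
  rw [← map_sum, h]

section Full

variable [Module.Finite R M] [Module.Projective R M]

theorem eq_of_forall_apply {x y : M} (h : ∀ f : RDual R A B M, f x = f y) : x = y :=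
  (Module.evalEquiv R M).injective (LinearMap.ext h)

/-- The module $M$ is reflexive over $R$, so `f` is the transpose of a unique map $M'\to M$. That
map is $A$-linear because every element of $A$ has the form $b\cdot 1$ and `f` commutes with $b$. -/
theorem exists_eq_map (hB : Function.Surjective fun b : B => b • (1 : A))
    (f : RDual R A B M →ₗ[B] RDual R A B M') : ∃ g : M' →ₗ[A] M, f = map g := by
  have hf : ∀ (r : R) φ, f (r • φ) = r • f φ := (f.restrictScalars R).map_smul
  let F : M' → Module.Dual R (Module.Dual R M) := fun x =>
    { toFun := fun φ => f φ x
      map_add' := fun φ ψ => congrArg (fun ψ : RDual R A B M' => ψ x) (map_add f φ ψ)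
      map_smul' := fun r φ => congrArg (fun ψ : RDual R A B M' => ψ x) (hf r φ) }
  let g : M' → M := fun x => (Module.evalEquiv R M).symm (F x)
  have hg : ∀ (φ : RDual R A B M) x, φ (g x) = f φ x := fun φ x => by
    have := LinearMap.congr_fun ((Module.evalEquiv R M).apply_symm_apply (F x)) φ
    exact this
  refine ⟨{ toFun := g, map_add' := fun x y => ?_, map_smul' := fun a x => ?_ }, ?_⟩
  · refine eq_of_forall_apply (R := R) (A := A) (B := B) fun φ => ?_
    rw [map_add, hg, hg, hg, map_add]
  · obtain ⟨b, rfl⟩ := hB a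
    refine eq_of_forall_apply (R := R) (A := A) (B := B) fun φ => ?_
    simp only [RingHom.id_apply]
    rw [hg, ← smul_apply, ← map_smul, ← hg, smul_apply]
  · exact LinearMap.ext fun φ => ext fun x => (hg φ x).symm

theorem hom_eq_zero (hB : Function.Surjective fun b : B => b • (1 : A))
    (h : ∀ g : M' →ₗ[A] M, g = 0) (f : RDual R A B M →ₗ[B] RDual R A B M') : f = 0 := by
  obtain ⟨g, rfl⟩ := exists_eq_map hB f
  rw [h g]
  exact LinearMap.ext fun φ => ext fun x => map_zero φ

theorem end_bijective (hB : Function.Surjective fun b : B => b • (1 : A))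
    (h : Function.Bijective (algebraMap R (Module.End A M))) :
    Function.Bijective (algebraMap R (Module.End B (RDual R A B M))) := by
  constructor
  · intro r s hrs
    refine h.1 (LinearMap.ext fun x => ?_)
    refine eq_of_forall_apply (R := R) (A := A) (B := B) fun φ => ?_
    simp only [Module.algebraMap_end_apply, map_smul]
    have := congrArg (fun ψ : RDual R A B M => ψ x) (LinearMap.congr_fun hrs φ)
    exact this
  · intro f
    obtain ⟨g, rfl⟩ := exists_eq_map hB f
    obtain ⟨r, rfl⟩ := h.2 g
    refine ⟨r, LinearMap.ext fun φ => ext fun x => ?_⟩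
    rw [map_apply, Module.algebraMap_end_apply, Module.algebraMap_end_apply, map_smul]
    rfl

end Full

section Filt

/-- The functionals vanishing on a submodule. -/
def annihilator (F : Submodule A M) : Submodule B (RDual R A B M) where
  carrier := {f | ∀ x ∈ F, f x = 0}
  add_mem' hf hg x hx := by rw [add_apply, hf x hx, hg x hx, add_zero]
  zero_mem' _ _ := rfl
  smul_mem' b f hf x hx := hf _ (F.smul_mem _ hx)

variable {Λ : Type*} {X : Λ → Type*} [∀ l, AddCommGroup (X l)] [∀ l, Module R (X l)]
  [∀ l, Module A (X l)] [∀ l, IsScalarTower R A (X l)] {S : Set Λ}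

/-- Restriction to $F'$ sends the functionals killing $F$ onto $D(F'/F)$, with kernel the
functionals killing $F'$. Surjectivity needs functionals on $F'$ to extend to $M$, which holds
because $M/F'$ is projective over $R$. -/
theorem filtStep_annihilator {F F' : Submodule A M} (h : FiltStep X S F F')
    [Module.Projective R (M ⧸ F')] :
    FiltStep (fun l => RDual R A B (X l)) S (annihilator (R := R) (B := B) F')
      (annihilator F) := by
  obtain ⟨hle, μ, hμ, h⟩ := h
  let q : annihilator (R := R) (B := B) F →ₗ[B] RDual R A B (SubQuot F F') :=
    { toFun := fun f => liftBase (F.submoduleOf F')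
        (LinearMap.comp (f : RDual R A B M) (F'.subtype.restrictScalars R)) fun x hx => f.2 x hx
      map_add' := fun f g => ext fun x => by
        obtain ⟨x, rfl⟩ := Submodule.Quotient.mk_surjective _ x
        rfl
      map_smul' := fun b f => ext fun x => by
        obtain ⟨x, rfl⟩ := Submodule.Quotient.mk_surjective _ x
        rfl }
  have hqa : ∀ f (x : F'), q f (Submodule.Quotient.mk x) = (f : RDual R A B M) x :=
    fun f x => rfl
  refine FiltStep.of_surjective (fun f hf x hx => hf x (hle hx)) hμ (inAdd h) q ?_ ?_
  · intro ψ
    obtain ⟨r, hr⟩ := exists_retraction (F'.subtype.restrictScalars R) F'.subtype_injective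
      (F'.mkQ.restrictScalars R) F'.mkQ_surjective (fun x => by
        simp only [LinearMap.coe_restrictScalars]
        simp)
    refine ⟨⟨LinearMap.comp ψ (((F.submoduleOf F').mkQ.restrictScalars R) ∘ₗ r), ?_⟩, ?_⟩
    · intro x hx
      have h1 : r x = ⟨x, hle hx⟩ := hr ⟨x, hle hx⟩
      have h2 : (F.submoduleOf F').mkQ (r x) = 0 := by
        rw [h1]
        exact (Submodule.Quotient.mk_eq_zero _).2 hx
      exact (congrArg ψ h2).trans (map_zero ψ)
    · ext x
      obtain ⟨x, rfl⟩ := Submodule.Quotient.mk_surjective _ x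
      rw [hqa]
      exact congrArg (fun y => ψ ((F.submoduleOf F').mkQ y)) (hr x)
  · intro f
    constructor
    · intro h x hx
      rw [← hqa f ⟨x, hx⟩, h]
      rfl
    · intro h
      ext x
      obtain ⟨x, rfl⟩ := Submodule.Quotient.mk_surjective _ x
      exact h x x.2

/-- The quotient $M/F$ is an extension of $M/F'$ by $F'/F$, and both are projective over $R$. -/
theorem projective_quotient_of_filtStep [∀ l, Module.Projective R (X l)] {F F' : Submodule A M}
    (h : FiltStep X S F F') [Module.Projective R (M ⧸ F')] : Module.Projective R (M ⧸ F) := by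
  obtain ⟨hle, μ, hμ, h⟩ := h
  have : Module.Projective R (SubQuot F F') := (h.restrictScalars R).projective
  let f : SubQuot F F' →ₗ[A] M ⧸ F := (F.submoduleOf F').mapQ F F'.subtype le_rfl
  let g : M ⧸ F →ₗ[A] M ⧸ F' := F.mapQ F' LinearMap.id hle
  refine projective_of_exact (f.restrictScalars R) ?_ (g.restrictScalars R) ?_ ?_
  · rw [LinearMap.coe_restrictScalars, ← LinearMap.ker_eq_bot, LinearMap.ker_eq_bot']
    intro x hx
    obtain ⟨x, rfl⟩ := Submodule.Quotient.mk_surjective _ x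
    exact (Submodule.Quotient.mk_eq_zero _).2 ((Submodule.Quotient.mk_eq_zero F).1 hx)
  · intro x
    obtain ⟨x, rfl⟩ := Submodule.Quotient.mk_surjective _ x
    exact ⟨Submodule.Quotient.mk x, rfl⟩
  · intro x
    obtain ⟨x, rfl⟩ := Submodule.Quotient.mk_surjective _ x
    constructor
    · intro hx
      exact ⟨Submodule.Quotient.mk ⟨x, (Submodule.Quotient.mk_eq_zero F').1 hx⟩, rfl⟩
    · rintro ⟨y, hy⟩
      obtain ⟨y, rfl⟩ := Submodule.Quotient.mk_surjective _ y
      have h1 : (y : M) - x ∈ F := (Submodule.Quotient.eq F).1 hy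
      refine (Submodule.Quotient.mk_eq_zero F').2 ?_
      simpa using F'.sub_mem y.2 (hle h1)

theorem projective_quotient_of_chain [∀ l, Module.Projective R (X l)] {F : Submodule A M}
    (h : Relation.ReflTransGen (FiltStep X S) F ⊤) : Module.Projective R (M ⧸ F) := by
  induction h using Relation.ReflTransGen.head_induction_on with
  | refl =>
    have : Subsingleton (M ⧸ (⊤ : Submodule A M)) := Submodule.Quotient.subsingleton_iff.2 rfl
    infer_instance
  | head h _ ih => exact projective_quotient_of_filtStep h

theorem _root_.SplitQH.Filt.projective [∀ l, Module.Projective R (X l)] (h : Filt A X S M) :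
    Module.Projective R M := by
  have := projective_quotient_of_chain (R := R) h
  exact Module.Projective.of_equiv
    ((Submodule.quotEquivOfEqBot (⊥ : Submodule A M) rfl).restrictScalars R)

theorem filt [∀ l, Module.Projective R (X l)] (h : Filt A X S M) :
    Filt B (fun l => RDual R A B (X l)) S (RDual R A B M) := by
  -- The chain is traversed from the top down: annihilators reverse inclusions, and projectivity of
  -- $M/F'$ is inherited from the steps above $F'$.
  have key : ∀ F : Submodule A M, Relation.ReflTransGen (FiltStep X S) F ⊤ →
      Relation.ReflTransGen (FiltStep (fun l => RDual R A B (X l)) S) ⊥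
        (annihilator (R := R) (B := B) F) := by
    intro F hF
    induction hF using Relation.ReflTransGen.head_induction_on with
    | refl =>
      rw [show annihilator (R := R) (B := B) (⊤ : Submodule A M) = ⊥ from
        eq_bot_iff.2 fun f hf => (Submodule.mem_bot B).2 (ext fun x => hf x trivial)]
    | head h h' ih =>
      have := projective_quotient_of_chain (R := R) h'
      exact ih.tail (filtStep_annihilator h)
  have := key ⊥ h
  rwa [show annihilator (R := R) (B := B) (⊥ : Submodule A M) = ⊤ from
    eq_top_iff.2 fun f _ x hx => by rw [(Submodule.mem_bot A).1 hx, map_zero]] at this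

end Filt

end RDual

namespace RegularDual

variable {R A : Type*} [CommRing R] [Ring A] [Algebra R A]

instance : Module R (RegularDual R A) := inferInstanceAs (Module R (A →ₗ[R] R))
instance : FunLike (RegularDual R A) A R := inferInstanceAs (FunLike (A →ₗ[R] R) A R)
instance : LinearMapClass (RegularDual R A) R A R :=
  inferInstanceAs (LinearMapClass (A →ₗ[R] R) R A R)

@[ext] theorem ext {f g : RegularDual R A} (h : ∀ x, f x = g x) : f = g := LinearMap.ext h

theorem smul_apply (a : A) (f : RegularDual R A) (x : A) : (a • f) x = f (x * a) := rfl
theorem base_smul_apply (r : R) (f : RegularDual R A) (x : A) : (r • f) x = r * f x := rfl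

instance : IsScalarTower R A (RegularDual R A) where
  smul_assoc r a f := ext fun x => by
    rw [smul_apply, base_smul_apply, smul_apply, mul_smul_comm, map_smul, smul_eq_mul]

end RegularDual

/-! ### Duals of regular modules, kernels and cokernels. -/

section Pair

variable {R A B : Type*} [CommRing R] [Ring A] [Algebra R A] [Ring B] [Algebra R B]
  [Module B A] [SMulCommClass A B A] [IsScalarTower R B A]

variable (R A B) in
/-- The algebra `B` acts on `A` from the right. -/
noncomputable def baseEquiv (hB : Function.Bijective fun b : B => b • (1 : A)) : B ≃ₗ[R] A :=
  LinearEquiv.ofBijective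
    { toFun := fun b => b • (1 : A)
      map_add' := fun b c => add_smul b c 1
      map_smul' := fun r b => smul_assoc r b (1 : A) } hB

theorem smul_one_mul (b : B) (a : A) : a * (b • (1 : A)) = b • a := by
  have := SMulCommClass.symm A B A
  rw [mul_smul_comm, mul_one]

variable (R A B) in
/-- The dual of the regular module over `A` is the relatively injective cogenerator for `B`. -/
noncomputable def regularDualEquiv (hB : Function.Bijective fun b : B => b • (1 : A)) :
    RDual R A B A ≃ₗ[B] RegularDual R B where
  toFun f := LinearMap.comp f (baseEquiv R A B hB).toLinearMap
  invFun f := LinearMap.comp f (baseEquiv R A B hB).symm.toLinearMap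
  left_inv f := RDual.ext fun x => congrArg f ((baseEquiv R A B hB).apply_symm_apply x)
  right_inv f := RegularDual.ext fun x => congrArg f ((baseEquiv R A B hB).symm_apply_apply x)
  map_add' _ _ := rfl
  map_smul' b f := RegularDual.ext fun x =>
    congrArg (fun a : A => f a) (RDual.smul_one_mul_smul_one b x)

variable (R A B) in
/-- Biduality for the regular module. -/
noncomputable def bidualEquiv [Module.Finite R A] [Module.Projective R A]
    (hB : Function.Bijective fun b : B => b • (1 : A)) :
    B ≃ₗ[B] RDual R A B (RegularDual R A) :=
  let g : B →ₗ[B] RDual R A B (RegularDual R A) :=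
    { toFun := fun b => show RDual R A B (RegularDual R A) from Module.Dual.eval R A (b • (1 : A))
      map_add' := fun b c => RDual.ext (M := RegularDual R A) fun f => by
        refine (congrArg (fun a : A => f a) (add_smul b c (1 : A))).trans ?_
        exact map_add f _ _
      map_smul' := fun b c => RDual.ext (M := RegularDual R A) fun f =>
        congrArg (fun a : A => f a) (RDual.smul_one_mul_smul_one c b).symm }
  LinearEquiv.ofBijective g ((Module.evalEquiv R A).bijective.comp hB)

variable {M N : Type*} [AddCommGroup M] [Module R M] [Module A M] [IsScalarTower R A M]
  [AddCommGroup N] [Module R N] [Module A N] [IsScalarTower R A N]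

theorem RDual.map_injective (g : M →ₗ[A] N) (hg : Function.Surjective g) :
    Function.Injective (RDual.map (R := R) (B := B) g) := fun f f' h => RDual.ext fun x => by
  obtain ⟨x, rfl⟩ := hg x
  exact congrArg (fun ψ : RDual R A B M => ψ x) h

theorem RDual.map_surjective (f : M →ₗ[A] N) (hf : Function.Injective f)
    {Q : Type*} [AddCommGroup Q] [Module R Q] [Module.Projective R Q] (g : N →ₗ[R] Q)
    (hg : Function.Surjective g) (h : Function.Exact f g) :
    Function.Surjective (RDual.map (R := R) (B := B) f) := fun ψ => by
  obtain ⟨r, hr⟩ := exists_retraction (f.restrictScalars R) hf g hg h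
  exact ⟨LinearMap.comp ψ r, RDual.ext fun x => congrArg ψ (hr x)⟩

variable (B) in
/-- The cokernel of the dual of a surjection is the dual of its kernel. -/
noncomputable def RDual.cokerEquiv (g : M →ₗ[A] N) (hg : Function.Surjective g)
    [Module.Projective R N] :
    (RDual R A B M ⧸ LinearMap.range (RDual.map (R := R) (B := B) g)) ≃ₗ[B]
      RDual R A B (LinearMap.ker g) :=
  (Submodule.quotEquivOfEq _ _ (by
    ext φ
    constructor
    · rintro ⟨ψ, rfl⟩
      exact RDual.ext fun x => (congrArg ψ x.2).trans (map_zero ψ)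
    · intro h
      -- A functional killing $\ker g$ descends to $N$; composing it with an $R$-linear section of
      -- `g` gives the descended functional.
      obtain ⟨s, hs⟩ := Module.projective_lifting_property (g.restrictScalars R) LinearMap.id hg
      have hs' : ∀ x, g (s x) = x := LinearMap.congr_fun hs
      have h0 : ∀ x, g x = 0 → φ x = 0 := fun x hx =>
        congrArg (fun ψ : RDual R A B (LinearMap.ker g) => ψ ⟨x, hx⟩) h
      refine ⟨LinearMap.comp φ s, RDual.ext fun x => ?_⟩
      have := h0 (s (g x) - x) (by rw [map_sub, hs', sub_self])
      rw [map_sub, sub_eq_zero] at this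
      exact this)).trans
  ((RDual.map (LinearMap.ker g).subtype).quotKerEquivOfSurjective
    (RDual.map_surjective _ (LinearMap.ker g).subtype_injective (g.restrictScalars R) hg
      (fun x => by simp)))

variable (B) in
/-- The kernel of the dual of an injection is the dual of its cokernel. -/
noncomputable def RDual.kerEquiv (f : M →ₗ[A] N) :
    RDual R A B (N ⧸ LinearMap.range f) ≃ₗ[B]
      LinearMap.ker (RDual.map (R := R) (B := B) f) :=
  (LinearEquiv.ofInjective (RDual.map (LinearMap.range f).mkQ)
    (RDual.map_injective _ (Submodule.mkQ_surjective _))).trans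
  (LinearEquiv.ofEq _ _ (by
    ext φ
    constructor
    · rintro ⟨ψ, rfl⟩
      exact RDual.ext fun x => (congrArg ψ
        ((Submodule.Quotient.mk_eq_zero _).2 ⟨x, rfl⟩)).trans (map_zero ψ)
    · intro h
      refine ⟨liftBase (LinearMap.range f) φ ?_, RDual.ext fun x => rfl⟩
      rintro _ ⟨x, rfl⟩
      exact congrArg (fun ψ : RDual R A B M => ψ x) h))

theorem RDual.map_surjective_of_projective (f : M →ₗ[A] N) (hf : Function.Injective f)
    [Module.Projective R (N ⧸ LinearMap.range f)] :
    Function.Surjective (RDual.map (R := R) (B := B) f) :=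
  RDual.map_surjective f hf ((LinearMap.range f).mkQ.restrictScalars R)
    (LinearMap.range f).mkQ_surjective (fun _ => Submodule.Quotient.mk_eq_zero (LinearMap.range f))

variable {Λ : Type*} {X : Λ → Type*} [∀ l, AddCommGroup (X l)] [∀ l, Module R (X l)]
  [∀ l, Module A (X l)] [∀ l, IsScalarTower R A (X l)] [∀ l, Module.Projective R (X l)]
  {S : Set Λ}

theorem RDual.filt_ker (f : M →ₗ[A] N) (h : Filt A X S (N ⧸ LinearMap.range f)) :
    Filt B (fun l => RDual R A B (X l)) S (LinearMap.ker (RDual.map (R := R) (B := B) f)) :=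
  (RDual.filt h).of_equiv (RDual.kerEquiv B f)

theorem RDual.filt_coker (g : M →ₗ[A] N) (hg : Function.Surjective g) [Module.Projective R N]
    (h : Filt A X S (LinearMap.ker g)) : Filt B (fun l => RDual R A B (X l)) S
      (RDual R A B M ⧸ LinearMap.range (RDual.map (R := R) (B := B) g)) :=
  (RDual.filt h).of_equiv (RDual.cokerEquiv B g hg).symm

end Pair

/-! ### Duality exchanges standard and costandard systems. -/

section Transfer

variable {R : Type u} {A B : Type v} [CommRing R] [Ring A] [Algebra R A] [Ring B] [Algebra R B]
  [Module.Finite R A] [Module.Projective R A]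
  [Module B A] [SMulCommClass A B A] [IsScalarTower R B A] {Λ : Type w} [PartialOrder Λ]

/-- Apply $D$ to all the data. A summand of $A^n$ dualizes to a summand of $(DA)^n$, and over
$B=A^{op}$ the module $DA$ is the regular dual of $B$. -/
theorem StdSystem.nonempty_costdSystem (hB : Function.Bijective fun b : B => b • (1 : A))
    (D : StdSystem R A Λ) : Nonempty (CostdSystem R B Λ) := by
  have : ∀ l, Module.Finite R (D.P l) := fun l => Module.Finite.trans A (D.P l)
  have : ∀ l, Module.Projective R (D.P l) := fun l =>
    ((inAdd_self_of_finite_projective (A := A) (N := D.P l)).restrictScalars R).projective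
  let e := regularDualEquiv R A B hB
  exact ⟨{
    N := fun l => RDual R A B (D.Δ l)
    I := fun l => RDual R A B (D.P l)
    hom_eq_zero := fun l m h => RDual.hom_eq_zero hB.2 (D.hom_eq_zero m l h)
    end_bijective := fun l => RDual.end_bijective hB.2 (D.end_bijective l)
    inAdd_dual := fun l => ((InAdd.refl B (RegularDual R B)).of_equiv e).trans
      (RDual.inAdd inAdd_self_of_finite_projective)
    ι := fun l => RDual.map (D.π l)
    ι_injective := fun l => RDual.map_injective _ (D.π_surjective l)
    filt_coker := fun l => RDual.filt_coker (D.π l) (D.π_surjective l) (D.filt_ker l)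
    generates := (RDual.inAddFamily D.generates).of_equiv e.symm }⟩

/-- Biduality makes the dual of the regular dual of $A$ the regular module of $B$, so duals of
relative injectives are projective. The cokernel of `ι` is $R$-projective by its filtration, which
makes the dual of `ι` surjective. -/
theorem CostdSystem.nonempty_stdSystem (hB : Function.Bijective fun b : B => b • (1 : A))
    (D : CostdSystem R A Λ) : Nonempty (StdSystem R B Λ) := by
  let e := bidualEquiv R A B hB
  have : ∀ l, Module.Finite B (RDual R A B (D.I l)) := fun l =>
    Module.Finite.of_restrictScalars_finite R B _
  have : ∀ l, Module.Projective B (RDual R A B (D.I l)) := fun l =>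
    (((InAdd.refl B B).of_equiv e.symm).trans (RDual.inAdd (D.inAdd_dual l))).projective
  exact ⟨{
    Δ := fun l => RDual R A B (D.N l)
    P := fun l => RDual R A B (D.I l)
    hom_eq_zero := fun l m h => RDual.hom_eq_zero hB.2 (D.hom_eq_zero m l h)
    end_bijective := fun l => RDual.end_bijective hB.2 (D.end_bijective l)
    π := fun l => RDual.map (D.ι l)
    π_surjective := fun l => by
      have := (D.filt_coker l).projective (R := R)
      exact RDual.map_surjective_of_projective _ (D.ι_injective l)
    filt_ker := fun l => RDual.filt_ker (D.ι l) (D.filt_coker l)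
    generates := (RDual.inAddFamily D.generates).of_equiv e }⟩

end Transfer

/-! ### Factorization of maps, and induction over upper sets. -/

section Factor

variable {A : Type*} [Ring A] {M N Z : Type*} [AddCommGroup M] [Module A M]
  [AddCommGroup N] [Module A N] [AddCommGroup Z] [Module A Z]

theorem exists_factor_of_surjective (p : M →ₗ[A] N) (hp : Function.Surjective p) (f : M →ₗ[A] Z)
    (h : ∀ x, p x = 0 → f x = 0) : ∃ g : N →ₗ[A] Z, ∀ x, g (p x) = f x := by
  refine ⟨(LinearMap.ker p).liftQ f (fun x hx => h x hx) ∘ₗ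
    (p.quotKerEquivOfSurjective hp).symm.toLinearMap, fun x => ?_⟩
  have : (p.quotKerEquivOfSurjective hp).symm (p x) = Submodule.Quotient.mk x := by
    rw [LinearEquiv.symm_apply_eq]
    rfl
  simp only [LinearMap.comp_apply, LinearEquiv.coe_coe, this]
  rfl

theorem exists_factor_of_injective (f : M →ₗ[A] N) (hf : Function.Injective f) (g : Z →ₗ[A] N)
    (h : ∀ z, ∃ x, f x = g z) : ∃ k : Z →ₗ[A] M, ∀ z, f (k z) = g z := by
  refine ⟨(LinearEquiv.ofInjective f hf).symm.toLinearMap ∘ₗ g.codRestrict _ h, fun z => ?_⟩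
  exact congrArg Subtype.val ((LinearEquiv.ofInjective f hf).apply_symm_apply ⟨g z, h z⟩)

theorem exists_lift_subQuot [Module.Projective A Z] {F F' : Submodule A M}
    (g : Z →ₗ[A] SubQuot F F') : ∃ f : Z →ₗ[A] F', ∀ z, Submodule.Quotient.mk (f z) = g z := by
  obtain ⟨f, hf⟩ := Module.projective_lifting_property (F.submoduleOf F').mkQ g
    (Submodule.mkQ_surjective _)
  exact ⟨f, LinearMap.congr_fun hf⟩

end Factor

/-- Upper sets of a finite poset are exhausted by adding one element at a time. -/
theorem upperSet_induction {Λ : Type*} [PartialOrder Λ] [Finite Λ] {S W : Set Λ}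
    (hS : IsUpperSet S) (hW : IsUpperSet W) (hSW : S ⊆ W) {Q : Set Λ → Prop} (h0 : Q S)
    (hstep : ∀ T μ, S ⊆ T → IsUpperSet T → μ ∉ T → IsUpperSet (insert μ T) → insert μ T ⊆ W →
      Q T → Q (insert μ T)) : Q W := by
  have key : ∀ n, ∀ V, IsUpperSet V → S ⊆ V → V ⊆ W → (V \ S).ncard = n → Q V := by
    intro n
    induction n with
    | zero =>
      intro V _ hSV _ hn
      rw [Set.ncard_eq_zero, Set.sdiff_eq_empty] at hn
      rwa [hn.antisymm hSV]
    | succ n ih =>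
      intro V hV hSV hVW hn
      have hne : (V \ S).Nonempty := by
        rw [Set.nonempty_iff_ne_empty]
        intro h
        rw [h, Set.ncard_empty] at hn
        omega
      -- Removing a minimal element of `V \ S` leaves an upper set: an element of $V$ strictly below
      -- `μ` would lie in the upper set $S$, forcing `μ ∈ S`.
      obtain ⟨μ, hμ⟩ := (Set.toFinite (V \ S)).exists_minimal hne
      have hu : IsUpperSet (V \ {μ}) := by
        rintro a b hab ⟨ha, ha'⟩
        refine ⟨hV hab ha, ?_⟩
        rintro rfl
        by_cases haS : a ∈ S
        · exact hμ.1.2 (hS hab haS)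
        · exact ha' (le_antisymm hab (hμ.2 ⟨ha, haS⟩ hab))
      have hins : insert μ (V \ {μ}) = V := Set.insert_sdiff_self_of_mem hμ.1.1
      have hsub : S ⊆ V \ {μ} := fun a ha => ⟨hSV ha, by rintro rfl; exact hμ.1.2 ha⟩
      have := hstep (V \ {μ}) μ hsub hu (by simp) (by rwa [hins]) (by rwa [hins])
        (ih _ hu hsub (Set.sdiff_subset.trans hVW) ?_)
      · rwa [hins] at this
      · rw [Set.sdiff_sdiff_comm, Set.ncard_sdiff_singleton_of_mem hμ.1, hn]
        rfl
  exact key _ W hW hSW le_rfl rfl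

/-! ### Traces of the projectives and the heredity chain. -/

namespace StdSystem

variable {R : Type u} {A : Type v} [CommRing R] [Ring A] [Algebra R A] {Λ : Type w}
  [PartialOrder Λ] (D : StdSystem R A Λ)

/-- The trace in `M` of the modules `P κ`, `κ ∈ S`. -/
def trace (S : Set Λ) (M : Type*) [AddCommGroup M] [Module A M] : Submodule A M :=
  ⨆ κ : S, ⨆ f : D.P κ →ₗ[A] M, LinearMap.range f

/-- There are no nonzero homomorphisms from `P κ`, `κ ∈ S`, to `M`. -/
def IsFree (S : Set Λ) (M : Type*) [AddCommGroup M] [Module A M] : Prop :=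
  ∀ κ ∈ S, ∀ f : D.P κ →ₗ[A] M, f = 0

variable {D} {S T : Set Λ} {M N X : Type*} [AddCommGroup M] [Module A M]
  [AddCommGroup N] [Module A N] [AddCommGroup X] [Module A X]

theorem mem_trace {κ : Λ} (hκ : κ ∈ S) (f : D.P κ →ₗ[A] M) (x : D.P κ) :
    f x ∈ D.trace S M := by
  have : LinearMap.range f ≤ D.trace S M := le_iSup_of_le (⟨κ, hκ⟩ : S)
    (le_iSup (fun f : D.P κ →ₗ[A] M => LinearMap.range f) f)
  exact this ⟨x, rfl⟩

theorem trace_le {F : Submodule A M} (h : ∀ κ ∈ S, ∀ (f : D.P κ →ₗ[A] M) x, f x ∈ F) :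
    D.trace S M ≤ F := by
  refine iSup_le fun κ => iSup_le fun f => ?_
  rintro _ ⟨x, rfl⟩
  exact h κ κ.2 f x

theorem trace_mono (h : S ⊆ T) : D.trace S M ≤ D.trace T M :=
  trace_le fun _ hκ f x => mem_trace (h hκ) f x

theorem map_mem_trace (g : M →ₗ[A] N) {x : M} (hx : x ∈ D.trace S M) : g x ∈ D.trace S N := by
  have : D.trace S M ≤ (D.trace S N).comap g := trace_le fun κ hκ f x =>
    mem_trace hκ (g ∘ₗ f) x
  exact this hx

theorem trace_empty : D.trace ∅ M = ⊥ :=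
  le_bot_iff.1 (trace_le fun _ h => h.elim)

theorem trace_eq_bot (h : D.IsFree S M) : D.trace S M = ⊥ :=
  le_bot_iff.1 (trace_le fun κ hκ f x => by rw [h κ hκ f]; rfl)

theorem trace_univ : D.trace Set.univ A = ⊤ := by
  obtain ⟨n, l, i, p, h⟩ := D.generates
  refine eq_top_iff.2 fun x _ => ?_
  rw [← h x]
  exact sum_mem fun k _ => mem_trace (Set.mem_univ _) _ _

theorem exists_mem_trace (g : M →ₗ[A] N) (hg : Function.Surjective g) {y : N}
    (hy : y ∈ D.trace S N) : ∃ x ∈ D.trace S M, g x = y := by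
  have : D.trace S N ≤ (D.trace S M).map g := trace_le fun κ hκ f x => by
    obtain ⟨k, hk⟩ := Module.projective_lifting_property g f hg
    exact ⟨k x, mem_trace hκ k x, LinearMap.congr_fun hk x⟩
  exact this hy

theorem IsFree.mono (hST : S ⊆ T) (h : D.IsFree T M) : D.IsFree S M := fun κ hκ => h κ (hST hκ)

theorem isFree_quotient_trace : D.IsFree S (M ⧸ D.trace S M) := fun κ hκ f => by
  obtain ⟨k, hk⟩ := Module.projective_lifting_property (D.trace S M).mkQ f
    (Submodule.mkQ_surjective _)
  ext x
  rw [← hk]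
  exact (Submodule.Quotient.mk_eq_zero _).2 (mem_trace hκ k x)

theorem IsFree.hom_Δ_eq_zero (h : D.IsFree S M) {κ : Λ} (hκ : κ ∈ S) (f : D.Δ κ →ₗ[A] M) :
    f = 0 := by
  ext x
  obtain ⟨x, rfl⟩ := D.π_surjective κ x
  exact LinearMap.congr_fun (h κ hκ (f ∘ₗ D.π κ)) x

theorem IsFree.hom_eq_zero (h : D.IsFree S N) (hM : Filt A D.Δ S M) (f : M →ₗ[A] N) : f = 0 :=
  hM.hom_eq_zero (fun _ hμ => h.hom_Δ_eq_zero hμ) f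

theorem trace_eq_top (hM : Filt A D.Δ S M) : D.trace S M = ⊤ := by
  have := isFree_quotient_trace.hom_eq_zero hM (D.trace S M).mkQ
  rw [← (D.trace S M).ker_mkQ, this, LinearMap.ker_zero]

/-- A module filtered by the $\Delta(\mu)$ with $\mu\in S$ equals its trace, since its quotient by
the trace receives no nonzero map from any such $\Delta(\mu)$. This applies to the kernel of `D.π
κ`. -/
theorem ker_π_le_trace {κ : Λ} (h : Set.Ioi κ ⊆ S) {x : D.P κ} (hx : D.π κ x = 0) :
    x ∈ D.trace S (D.P κ) := by
  have h1 : (⟨x, hx⟩ : LinearMap.ker (D.π κ)) ∈ D.trace (Set.Ioi κ) _ := by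
    rw [trace_eq_top (D.filt_ker κ)]
    trivial
  exact trace_mono h (map_mem_trace (LinearMap.ker (D.π κ)).subtype h1)

theorem exists_factor_π {κ : Λ} (h : ∀ μ > κ, ∀ f : D.Δ μ →ₗ[A] M, f = 0) (f : D.P κ →ₗ[A] M) :
    ∃ g : D.Δ κ →ₗ[A] M, ∀ x, g (D.π κ x) = f x :=
  exists_factor_of_surjective _ (D.π_surjective κ) f fun x hx =>
    LinearMap.congr_fun ((D.filt_ker κ).hom_eq_zero h
      (f ∘ₗ (LinearMap.ker (D.π κ)).subtype)) ⟨x, hx⟩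

/-- The kernel of $P(\kappa)\to\Delta(\kappa)$ is filtered by $\Delta(\mu)$ with $\mu>\kappa$, hence
$\mu\not\le\nu$. So the map factors through $\Delta(\kappa)$, which has no nonzero map to
$\Delta(\nu)$. -/
theorem hom_P_Δ_eq_zero {κ ν : Λ} (h : ¬ κ ≤ ν) (f : D.P κ →ₗ[A] D.Δ ν) : f = 0 := by
  obtain ⟨g, hg⟩ := exists_factor_π (fun μ hμ => D.hom_eq_zero μ ν
    fun hle => h (le_of_lt (lt_of_lt_of_le hμ hle))) f
  ext x
  rw [← hg, D.hom_eq_zero κ ν h g]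
  rfl

theorem isFree_of_inAdd {ν : Λ} (h : ∀ κ ∈ S, ¬ κ ≤ ν) (hX : InAdd A (D.Δ ν) X) :
    D.IsFree S X := fun _ hκ => hX.hom_eq_zero' (hom_P_Δ_eq_zero (h _ hκ))

/-- A stand-in for vanishing of $\operatorname{Ext}^1$. Lift $P(\nu)\to\Delta(\nu)\to X$ to $M$ by
projectivity; the lift sends the kernel of `D.π ν` into $\ker g$, where it vanishes because that
kernel is filtered by $\Delta(\mu)$ with $\mu>\nu$. The lift therefore descends to $\Delta(\nu)$. -/
theorem exists_section {ν : Λ} (hX : InAdd A (D.Δ ν) X) (g : M →ₗ[A] X)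
    (hg : Function.Surjective g) (h : D.IsFree (Set.Ioi ν) (LinearMap.ker g)) :
    ∃ s : X →ₗ[A] M, ∀ x, g (s x) = x := by
  obtain ⟨n, i, p, hip⟩ := hX.exists_sum_eq_id
  have key : ∀ k, ∃ s : D.Δ ν →ₗ[A] M, ∀ x, g (s x) = p k x := fun k => by
    obtain ⟨t, ht⟩ := Module.projective_lifting_property g (p k ∘ₗ D.π ν) hg
    have ht' : ∀ x, g (t x) = p k (D.π ν x) := LinearMap.congr_fun ht
    let t' : LinearMap.ker (D.π ν) →ₗ[A] LinearMap.ker g :=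
      (t ∘ₗ (LinearMap.ker (D.π ν)).subtype).codRestrict _ fun x => by
        rw [LinearMap.mem_ker, LinearMap.comp_apply, ht']
        exact (congrArg (p k) x.2).trans (map_zero _)
    have h0 : t' = 0 := h.hom_eq_zero (D.filt_ker ν) t'
    obtain ⟨s, hs⟩ := exists_factor_of_surjective _ (D.π_surjective ν) t fun x hx =>
      congrArg Subtype.val (LinearMap.congr_fun h0 ⟨x, hx⟩)
    refine ⟨s, fun x => ?_⟩
    obtain ⟨x, rfl⟩ := D.π_surjective ν x
    rw [hs, ht']
  choose s hs using key
  refine ⟨∑ k, s k ∘ₗ i k, fun x => ?_⟩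
  simp only [LinearMap.sum_apply, map_sum, LinearMap.comp_apply, hs, hip]

variable (f : M →ₗ[A] N) (hf : Function.Injective f) (g : N →ₗ[A] X)
  (hg : Function.Surjective g) (h : Function.Exact f g)

include hf hg h in
-- Traces do not restrict to submodules in general; they do when the quotient lies in
-- $\operatorname{add}\Delta(\nu)$.
theorem mem_trace_of_exact (hS : IsUpperSet S) {ν : Λ} (hX : InAdd A (D.Δ ν) X) {x : M}
    (hx : f x ∈ D.trace S N) : x ∈ D.trace S M := by
  by_cases hν : ν ∈ S
  -- Modulo the trace of $M$, the kernel of the map to $X$ receives nothing from $P(\kappa)$,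
  -- $\kappa\in S$, so the sequence splits. Every map $P(\kappa)\to N/K$ then has image in the
  -- section, which meets the kernel in zero.
  · let K := (D.trace S M).map f
    let g' : (N ⧸ K) →ₗ[A] X := K.liftQ g (by
      rintro _ ⟨y, _, rfl⟩
      exact h.apply_apply_eq_zero y)
    have hg' : Function.Surjective g' := fun y => by
      obtain ⟨z, rfl⟩ := hg y
      exact ⟨Submodule.Quotient.mk z, rfl⟩
    let φ : M →ₗ[A] LinearMap.ker g' := (K.mkQ ∘ₗ f).codRestrict _ h.apply_apply_eq_zero
    have hφ : Function.Surjective φ := by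
      rintro ⟨y, hy⟩
      obtain ⟨y, rfl⟩ := Submodule.Quotient.mk_surjective _ y
      obtain ⟨z, rfl⟩ := (h y).1 hy
      exact ⟨z, rfl⟩
    have hfree : D.IsFree S (LinearMap.ker g') := fun κ hκ k => by
      obtain ⟨k', hk'⟩ := Module.projective_lifting_property φ k hφ
      ext y
      rw [← hk']
      exact (Submodule.Quotient.mk_eq_zero K).2 ⟨k' y, mem_trace hκ k' y, rfl⟩
    obtain ⟨s, hs⟩ := exists_section hX g' hg'
      (hfree.mono fun κ hκ => hS (le_of_lt hκ) hν)
    have hle : D.trace S N ≤ (LinearMap.range s).comap K.mkQ := trace_le fun κ hκ k y => by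
      let d : D.P κ →ₗ[A] LinearMap.ker g' :=
        ((LinearMap.id - s ∘ₗ g' : (N ⧸ K) →ₗ[A] (N ⧸ K)) ∘ₗ K.mkQ ∘ₗ k).codRestrict _
          fun y => by simp [hs]
      have hd := congrArg Subtype.val (LinearMap.congr_fun (hfree κ hκ d) y)
      exact ⟨g' (K.mkQ (k y)), (sub_eq_zero.1 hd).symm⟩
    obtain ⟨z, hz⟩ := hle hx
    have hz0 : z = 0 := by
      rw [← hs z, hz]
      exact h.apply_apply_eq_zero x
    rw [hz0, map_zero] at hz
    obtain ⟨y, hy, hyx⟩ := (Submodule.Quotient.mk_eq_zero K).1 hz.symm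
    rwa [← hf hyx]
  -- If $\nu\notin S$, no $P(\kappa)$ with $\kappa\in S$ maps nontrivially to $X$, so all maps
  -- $P(\kappa)\to N$ factor through $M$.
  · have hle : D.trace S N ≤ (D.trace S M).map f := trace_le fun κ hκ k y => by
      have h0 := isFree_of_inAdd (D := D) (S := S) (fun κ hκ hle => hν (hS hle hκ)) hX κ hκ
        (g ∘ₗ k)
      obtain ⟨k', hk'⟩ := exists_factor_of_injective f hf k fun z =>
        (h _).1 (LinearMap.congr_fun h0 z)
      exact ⟨k' y, mem_trace hκ k' y, hk' y⟩
    obtain ⟨y, hy, hyx⟩ := hle hx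
    rwa [← hf hyx]

variable (D S T) in
/-- The map induced on subquotients by traces. -/
def traceMap (f : M →ₗ[A] N) : SubQuot (D.trace S M) (D.trace T M) →ₗ[A]
    SubQuot (D.trace S N) (D.trace T N) :=
  Submodule.mapQ _ _ (f.restrict fun _ hx => map_mem_trace f hx) fun _ hx => map_mem_trace f hx

theorem traceMap_mk (f : M →ₗ[A] N) (x : D.trace T M) :
    D.traceMap S T f (Submodule.Quotient.mk x) =
      Submodule.Quotient.mk ⟨f x, map_mem_trace f x.2⟩ := rfl

theorem subQuot_mk_eq_zero {F F' : Submodule A M} {x : F'} :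
    (Submodule.Quotient.mk x : SubQuot F F') = 0 ↔ (x : M) ∈ F :=
  Submodule.Quotient.mk_eq_zero _

theorem subsingleton_subQuot {F F' : Submodule A M} (h : F' ≤ F) : Subsingleton (SubQuot F F') :=
  Submodule.Quotient.subsingleton_iff.2 (eq_top_iff.2 fun x _ => h x.2)

variable {μ : Λ} (hS : IsUpperSet S) (hμ : μ ∉ S) (hT : IsUpperSet (insert μ S))

theorem trace_eq_top_of_inAdd {ν : Λ} (hν : ν ∈ S) (hX : InAdd A (D.Δ ν) X) :
    D.trace S X = ⊤ := by
  have := hX.hom_eq_zero (isFree_quotient_trace (D := D).hom_Δ_eq_zero hν) (D.trace S X).mkQ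
  rw [← (D.trace S X).ker_mkQ, this, LinearMap.ker_zero]

include hS hμ hT in
-- The trace of an upper set in $X\in\operatorname{add}\Delta(\nu)$ is everything or zero, according
-- to whether $\nu$ belongs to the set. Hence the section at `μ` is $X$ if $\nu=\mu$ and zero
-- otherwise.
theorem inAdd_subQuot_trace_of_inAdd {ν : Λ} (hX : InAdd A (D.Δ ν) X) :
    InAdd A (D.Δ μ) (SubQuot (D.trace S X) (D.trace (insert μ S) X)) := by
  by_cases hνS : ν ∈ S
  · have := subsingleton_subQuot (F := D.trace S X) (F' := D.trace (insert μ S) X)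
      (by rw [trace_eq_top_of_inAdd hνS hX]; exact le_top)
    exact InAdd.of_subsingleton
  by_cases hνμ : ν = μ
  · subst hνμ
    refine hX.of_equiv (subQuotEquiv (D.trace (insert ν S) X).subtype ?_ ?_)
    · rw [← LinearMap.range_eq_top, Submodule.range_subtype,
        trace_eq_top_of_inAdd (Set.mem_insert ν S) hX]
    · rw [trace_eq_bot (isFree_of_inAdd (fun κ hκ hle => hνS (hS hle hκ)) hX)]
      simp
  · have := subsingleton_subQuot (F := D.trace S X) (F' := D.trace (insert μ S) X) (by
      rw [trace_eq_bot (isFree_of_inAdd (fun κ hκ hle => ?_) hX)]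
      · exact bot_le
      · rcases hT hle hκ with h | h
        exacts [hνμ h, hνS h])
    exact InAdd.of_subsingleton

include hf hg h hS hμ hT in
-- The sections of $M$, $N$, $X$ form a short exact sequence by `mem_trace_of_exact`, used for `S`
-- and for `insert μ S`. Its outer terms lie in $\operatorname{add}\Delta(\mu)$, so it splits by
-- `exists_section`.
theorem inAdd_subQuot_trace_of_exact {ν : Λ} (hX : InAdd A (D.Δ ν) X)
    (hM : InAdd A (D.Δ μ) (SubQuot (D.trace S M) (D.trace (insert μ S) M))) :
    InAdd A (D.Δ μ) (SubQuot (D.trace S N) (D.trace (insert μ S) N)) := by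
  let q := D.traceMap S (insert μ S) g
  have hq : Function.Surjective q := fun y => by
    obtain ⟨⟨y, hy⟩, rfl⟩ := Submodule.Quotient.mk_surjective _ y
    obtain ⟨x, hx, rfl⟩ := exists_mem_trace g hg hy
    exact ⟨Submodule.Quotient.mk ⟨x, hx⟩, rfl⟩
  have hqj : ∀ x, D.traceMap S (insert μ S) f x ∈ LinearMap.ker q := fun x => by
    obtain ⟨x, rfl⟩ := Submodule.Quotient.mk_surjective _ x
    rw [LinearMap.mem_ker, traceMap_mk, traceMap_mk, subQuot_mk_eq_zero]
    simp only [h.apply_apply_eq_zero]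
    exact zero_mem _
  have e : SubQuot (D.trace S M) (D.trace (insert μ S) M) ≃ₗ[A] LinearMap.ker q := by
    refine LinearEquiv.ofBijective ((D.traceMap S (insert μ S) f).codRestrict _ hqj) ⟨?_, ?_⟩
    · rw [← LinearMap.ker_eq_bot, LinearMap.ker_eq_bot']
      intro x hx
      obtain ⟨x, rfl⟩ := Submodule.Quotient.mk_surjective _ x
      have hx' := congrArg Subtype.val hx
      exact subQuot_mk_eq_zero.2
        (mem_trace_of_exact f hf g hg h hS hX (subQuot_mk_eq_zero.1 hx'))
    · rintro ⟨y, hy⟩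
      obtain ⟨⟨y, hyT⟩, rfl⟩ := Submodule.Quotient.mk_surjective _ y
      obtain ⟨z, hz, hzy⟩ := exists_mem_trace g hg (subQuot_mk_eq_zero.1 hy)
      obtain ⟨x, hx⟩ := (h (y - z)).1 (by rw [map_sub, hzy]; exact sub_self _)
      have hxT : x ∈ D.trace (insert μ S) M := mem_trace_of_exact f hf g hg h hT hX (by
        rw [hx]
        exact sub_mem hyT (trace_mono (Set.subset_insert μ S) hz))
      refine ⟨Submodule.Quotient.mk ⟨x, hxT⟩, Subtype.ext ?_⟩
      refine (Submodule.Quotient.eq _).2 ?_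
      change f x - y ∈ D.trace S N
      rw [hx, sub_sub_cancel_left]
      exact neg_mem hz
  have hker := hM.of_equiv e.symm
  have hQX := inAdd_subQuot_trace_of_inAdd hS hμ hT hX
  obtain ⟨s, hs⟩ := exists_section hQX q hq
    (isFree_of_inAdd (fun κ hκ hle => lt_irrefl μ (lt_of_lt_of_le hκ hle)) hker)
  exact InAdd.of_section q s hs hQX hker

theorem inAdd_subQuot_trace_of_family {ι : Type*} [Fintype ι] {Y : ι → Type*}
    [∀ a, AddCommGroup (Y a)] [∀ a, Module A (Y a)] {L : Type*} [AddCommGroup L] [Module A L]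
    (hY : ∀ a, InAdd A L (SubQuot (D.trace S (Y a)) (D.trace T (Y a))))
    (i : ∀ a, M →ₗ[A] Y a) (p : ∀ a, Y a →ₗ[A] M) (hip : ∀ x, ∑ a, p a (i a x) = x) :
    InAdd A L (SubQuot (D.trace S M) (D.trace T M)) := by
  refine InAdd.of_family hY (fun a => D.traceMap S T (i a)) (fun a => D.traceMap S T (p a))
    fun x => ?_
  obtain ⟨x, rfl⟩ := Submodule.Quotient.mk_surjective _ x
  simp only [traceMap_mk]
  have : ∑ a, (⟨p a (i a x), map_mem_trace (p a) (map_mem_trace (i a) x.2)⟩ : D.trace T M) = x :=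
    Subtype.ext (by simp [hip])
  conv_rhs => rw [← this]
  exact (map_sum (Submodule.mkQ _) _ _).symm

include hS hμ hT in
theorem inAdd_subQuot_trace_of_filt {V : Set Λ} (hM : Filt A D.Δ V M) :
    InAdd A (D.Δ μ) (SubQuot (D.trace S M) (D.trace (insert μ S) M)) := by
  have key : ∀ F : Submodule A M, Relation.ReflTransGen (FiltStep D.Δ V) ⊥ F →
      InAdd A (D.Δ μ) (SubQuot (D.trace S F) (D.trace (insert μ S) F)) := by
    intro F hF
    induction hF with
    | refl =>
      have := subsingleton_subQuot (F := D.trace S (⊥ : Submodule A M))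
        (F' := D.trace (insert μ S) (⊥ : Submodule A M)) (fun x _ => by
          rw [Subsingleton.elim x 0]; exact zero_mem _)
      exact InAdd.of_subsingleton
    | @tail F F' _ hs ih =>
      obtain ⟨hle, ν, _, hX⟩ := hs
      exact inAdd_subQuot_trace_of_exact (Submodule.inclusion hle)
        (Submodule.inclusion_injective hle) (F.submoduleOf F').mkQ (Submodule.mkQ_surjective _)
        (fun x => by
          rw [Submodule.mkQ_apply, subQuot_mk_eq_zero]
          exact ⟨fun hx => ⟨⟨x, hx⟩, rfl⟩, fun ⟨y, hy⟩ => hy ▸ y.2⟩) hS hμ hT hX ih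
  exact inAdd_subQuot_trace_of_family (ι := Unit) (fun _ => key ⊤ hM)
    (fun _ => Submodule.topEquiv.symm.toLinearMap) (fun _ => Submodule.topEquiv.toLinearMap)
    (by simp)

variable (D) in
include hS hμ hT in
-- The regular module is a retract of a sum of modules $P(l)$, each an extension of $\Delta(l)$ by a
-- filtered kernel.
theorem inAdd_subQuot_trace :
    InAdd A (D.Δ μ) (SubQuot (D.trace S A) (D.trace (insert μ S) A)) := by
  obtain ⟨n, l, i, p, h⟩ := D.generates
  refine inAdd_subQuot_trace_of_family (fun k => ?_) i p h
  exact inAdd_subQuot_trace_of_exact (LinearMap.ker (D.π (l k))).subtype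
    (Submodule.subtype_injective _) (D.π (l k)) (D.π_surjective _) (fun x => by simp) hS hμ hT
    (InAdd.refl A _) (inAdd_subQuot_trace_of_filt hS hμ hT (D.filt_ker (l k)))

variable (D) in
-- Enlarging $S$ one element at a time up to all of $\Lambda$ filters $A/\operatorname{tr}_S A$ by
-- members of the categories $\operatorname{add}\Delta(\mu)$, which are projective over $R$.
theorem projective_quotient_trace [Finite Λ] (hS : IsUpperSet S) :
    Module.Projective R (A ⧸ D.trace S A) := by
  have key : Relation.ReflTransGen (FiltStep D.Δ Set.univ) (D.trace S A)
      (D.trace Set.univ A) := by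
    refine upperSet_induction hS isUpperSet_univ (Set.subset_univ S)
      (Q := fun V => Relation.ReflTransGen (FiltStep D.Δ Set.univ) (D.trace S A) (D.trace V A))
      .refl fun V μ _ hV hμ hT _ ih => ?_
    exact ih.tail ⟨trace_mono (Set.subset_insert _ _), μ, trivial,
      inAdd_subQuot_trace D hV hμ hT⟩
  rw [trace_univ] at key
  exact RDual.projective_quotient_of_chain key

/-- If `Z` has no homomorphisms to `Δ κ` for `κ ∈ T \ S`, then homomorphisms from `Z` to the
trace of `T` land in the trace of `S`. -/
theorem mem_trace_of_mem_trace [Finite Λ] (hS : IsUpperSet S) (hT : IsUpperSet T) (hST : S ⊆ T)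
    (h0 : ∀ κ ∈ T, κ ∉ S → ∀ f : M →ₗ[A] D.Δ κ, f = 0) (f : M →ₗ[A] A)
    (hf : ∀ x, f x ∈ D.trace T A) (x : M) : f x ∈ D.trace S A := by
  refine upperSet_induction hS hT hST (Q := fun V => (∀ x, f x ∈ D.trace V A) →
      ∀ x, f x ∈ D.trace S A) id (fun V μ hSV hV hμ hVT hle ih hf => ih fun x => ?_) hf x
  have := (inAdd_subQuot_trace D hV hμ hVT).hom_eq_zero'
    (h0 μ (hle (Set.mem_insert _ _)) fun h => hμ (hSV h))
    (((D.trace V A).submoduleOf (D.trace (insert μ V) A)).mkQ ∘ₗ f.codRestrict _ hf)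
  exact subQuot_mk_eq_zero.1 (LinearMap.congr_fun this x)

end StdSystem

/-! ### Hom modules into bimodules. -/

section Hom

variable {R A B : Type*} [CommRing R] [Ring A] [Algebra R A] [Ring B]
  {N Q X : Type*} [AddCommGroup N] [Module A N] [Module B N] [SMulCommClass A B N]
  [AddCommGroup Q] [Module A Q] [AddCommGroup X] [Module R X] [Module A X] [IsScalarTower R A X]

variable (B N) in
/-- Precomposition with an `A`-linear map. -/
def precomp {Q' : Type*} [AddCommGroup Q'] [Module A Q'] (g : Q →ₗ[A] Q') :
    (Q' →ₗ[A] N) →ₗ[B] (Q →ₗ[A] N) where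
  toFun f := f ∘ₗ g
  map_add' _ _ := rfl
  map_smul' _ _ := rfl

variable (A B N) in
/-- Evaluation at an element. -/
def evalHom (x : Q) : (Q →ₗ[A] N) →ₗ[B] N where
  toFun f := f x
  map_add' _ _ := rfl
  map_smul' _ _ := rfl

variable (B N) in
/-- The map `y ↦ (x ↦ h x • y)`. -/
def smulRightHom (h : Q →ₗ[A] A) : N →ₗ[B] (Q →ₗ[A] N) where
  toFun y := LinearMap.toSpanSingleton A N y ∘ₗ h
  map_add' _ _ := LinearMap.ext fun _ => smul_add _ _ _
  map_smul' _ _ := LinearMap.ext fun _ => smul_comm _ _ _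

theorem smulRightHom_apply (h : Q →ₗ[A] A) (y : N) (x : Q) :
    smulRightHom B N h y x = h x • y := rfl

theorem exists_dualBasis [Module.Finite A Q] [Module.Projective A Q] :
    ∃ (n : ℕ) (h : Fin n → Q →ₗ[A] A) (y : Fin n → Q), ∀ x, ∑ k, h k x • y k = x := by
  obtain ⟨n, i, p, h⟩ := (inAdd_self_of_finite_projective (A := A) (N := Q)).exists_sum_eq_id
  refine ⟨n, i, fun k => p k 1, fun x => ?_⟩
  conv_rhs => rw [← h x]
  exact Finset.sum_congr rfl fun k _ => by rw [← map_smul, smul_eq_mul, mul_one]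

theorem inAdd_hom_of_projective [Module.Finite A Q] [Module.Projective A Q] :
    InAdd B N (Q →ₗ[A] N) := by
  obtain ⟨n, h, y, hy⟩ := exists_dualBasis (A := A) (Q := Q)
  refine InAdd.of_sum_eq_id (fun k => evalHom A B N (y k)) (fun k => smulRightHom B N (h k)) ?_
  refine LinearMap.ext fun f => LinearMap.ext fun x => ?_
  simp only [LinearMap.sum_apply, LinearMap.comp_apply, LinearMap.id_apply, smulRightHom_apply]
  conv_rhs => rw [← hy x, map_sum]
  exact Finset.sum_congr rfl fun k _ => (map_smul f _ _).symm

/-- If the endomorphisms of `X` are scalars and the bimodule `N` lies in `add X` as a left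
module, then `Hom(Q, N)` lies in `add Hom(X, N)`. -/
theorem inAdd_hom (hX : Function.Surjective (algebraMap R (Module.End A X))) (hN : InAdd A X N)
    [Module.Finite R (Q →ₗ[A] X)] [Module.Projective R (Q →ₗ[A] X)] :
    InAdd B (X →ₗ[A] N) (Q →ₗ[A] N) := by
  obtain ⟨n, i, p, hip⟩ := hN.exists_sum_eq_id
  obtain ⟨m, φ, g, hφ⟩ := exists_dualBasis (A := R) (Q := Q →ₗ[A] X)
  have hg : ∀ (f : Q →ₗ[A] X) x, ∑ l, φ l f • g l x = f x := fun f x => by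
    conv_rhs => rw [← hφ f]
    simp [LinearMap.sum_apply]
  -- Under $\operatorname{Hom}(Q,N)\cong\operatorname{Hom}(Q,X)\otimes_R\operatorname{Hom}(X,N)$,
  -- this applies the coordinate `φ l` to the first factor.
  let I : Fin m → (Q →ₗ[A] N) →ₗ[B] (X →ₗ[A] N) := fun l =>
    { toFun := fun f => ∑ k, p k ∘ₗ algebraMap R (Module.End A X) (φ l (i k ∘ₗ f))
      map_add' := fun f f' => by
        simp only [LinearMap.comp_add, map_add, Finset.sum_add_distrib]
      map_smul' := fun b f => by
        -- The maps `i` and `p` are not $B$-linear, but in these coordinates $b$ acts by a matrix of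
        -- endomorphisms of $X$, that is, of scalars, which the coordinates `φ l` respect.
        choose r hr using fun k' k => hX (i k' ∘ₗ (b • p k))
        have hr' : ∀ k' k x, i k' (b • p k x) = r k' k • x := fun k' k x =>
          (LinearMap.congr_fun (hr k' k) x).symm
        have h1 : ∀ k', i k' ∘ₗ (b • f) = ∑ k, r k' k • (i k ∘ₗ f) := fun k' => by
          ext x
          simp only [LinearMap.comp_apply, LinearMap.smul_apply, LinearMap.sum_apply, ← hr',
            ← map_sum, ← Finset.smul_sum, hip]
        ext x
        simp only [LinearMap.sum_apply, LinearMap.comp_apply, RingHom.id_apply,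
          LinearMap.smul_apply, Module.algebraMap_end_apply, h1, map_sum, map_smul, smul_eq_mul,
          Finset.smul_sum]
        rw [Finset.sum_comm]
        refine Finset.sum_congr rfl fun k _ => ?_
        conv_rhs => rw [← hip (b • p k (φ l (i k ∘ₗ f) • x))]
        exact Finset.sum_congr rfl fun k' _ => by rw [hr', smul_smul] }
  refine InAdd.of_sum_eq_id I (fun l => precomp B N (g l)) ?_
  refine LinearMap.ext fun f => LinearMap.ext fun x => ?_
  simp only [LinearMap.sum_apply, LinearMap.comp_apply, LinearMap.id_apply, I, precomp,
    LinearMap.coe_mk, AddHom.coe_mk, Module.algebraMap_end_apply]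
  rw [Finset.sum_comm]
  conv_rhs => rw [← hip (f x)]
  refine Finset.sum_congr rfl fun k _ => ?_
  rw [← map_sum, hg]
  rfl

end Hom

/-! ### The standard system of the opposite algebra. -/

namespace StdSystem

variable {R : Type u} {A B : Type v} [CommRing R] [Ring A] [Algebra R A] [Ring B] [Algebra R B]
  [Module B A] [SMulCommClass A B A] [IsScalarTower R B A] {Λ : Type w} [PartialOrder Λ]
  (D : StdSystem R A Λ) {S T : Set Λ}

variable (A) in
/-- The action of an element of `B` on `A`. -/
def actMap (b : B) : A →ₗ[A] A where
  toFun x := b • x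
  map_add' := smul_add b
  map_smul' a x := (smul_comm a b x).symm

variable (B S) in
/-- The homomorphisms from `P l` to `A` with values in the trace of `S`. -/
def homTrace (l : Λ) : Submodule B (D.P l →ₗ[A] A) where
  carrier := {f | ∀ x, f x ∈ D.trace S A}
  add_mem' hf hg x := add_mem (hf x) (hg x)
  zero_mem' _ := zero_mem _
  smul_mem' b _ hf x := map_mem_trace (actMap A b) (hf x)

variable (B) in
/-- The standard modules over the opposite algebra. -/
abbrev OpΔ (l : Λ) : Type _ := (D.P l →ₗ[A] A) ⧸ D.homTrace B {κ | ¬ κ ≤ l} l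

theorem isUpperSet_not_le (l : Λ) : IsUpperSet {κ : Λ | ¬ κ ≤ l} :=
  fun _ _ hab ha hb => ha (hab.trans hb)

theorem Ioi_subset_not_le (l : Λ) : Set.Ioi l ⊆ {κ : Λ | ¬ κ ≤ l} :=
  fun _ hκ hle => lt_irrefl l (lt_of_lt_of_le hκ hle)

variable (B) in
/-- `OpΔ l` as a module of homomorphisms. -/
noncomputable def opΔEquiv (l : Λ) :
    D.OpΔ B l ≃ₗ[R] (D.P l →ₗ[A] (A ⧸ D.trace {κ | ¬ κ ≤ l} A)) :=
  let q : (D.P l →ₗ[A] A) →ₗ[R] (D.P l →ₗ[A] (A ⧸ D.trace {κ | ¬ κ ≤ l} A)) :=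
    { toFun := fun f => (D.trace {κ | ¬ κ ≤ l} A).mkQ ∘ₗ f
      map_add' := fun _ _ => LinearMap.comp_add _ _ _
      map_smul' := fun _ _ => rfl }
  have hq : ∀ f, q f = 0 ↔ f ∈ D.homTrace B {κ | ¬ κ ≤ l} l := fun f => by
    rw [LinearMap.ext_iff]
    exact forall_congr' fun x => Submodule.Quotient.mk_eq_zero _
  LinearEquiv.ofBijective (liftBase (D.homTrace B {κ | ¬ κ ≤ l} l) q fun f hf => (hq f).2 hf) <| by
    constructor
    · rw [← LinearMap.ker_eq_bot, LinearMap.ker_eq_bot']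
      intro f hf
      obtain ⟨f, rfl⟩ := Submodule.Quotient.mk_surjective _ f
      exact (Submodule.Quotient.mk_eq_zero _).2 ((hq f).1 hf)
    · intro f
      obtain ⟨k, hk⟩ := Module.projective_lifting_property (D.trace {κ | ¬ κ ≤ l} A).mkQ f
        (Submodule.mkQ_surjective _)
      exact ⟨Submodule.Quotient.mk k, hk⟩

theorem finite_projective_opΔ [Module.Finite R A] [Finite Λ] (l : Λ) :
    Module.Finite R (D.OpΔ B l) ∧ Module.Projective R (D.OpΔ B l) := by
  have := D.projective_quotient_trace (isUpperSet_not_le l)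
  have h : InAdd R (A ⧸ D.trace {κ | ¬ κ ≤ l} A) (D.OpΔ B l) :=
    inAdd_hom_of_projective.of_equiv (D.opΔEquiv B l)
  exact ⟨h.finite, h.projective⟩

variable {D} in
/-- Homomorphisms between the modules `OpΔ` are induced by homomorphisms between the `P l`. -/
theorem exists_hom_opΔ_eq (hB : Function.Surjective fun b : B => b • (1 : A)) {m l : Λ}
    (f : D.OpΔ B m →ₗ[B] D.OpΔ B l) : ∃ φ : D.P l →ₗ[A] D.P m, ∀ h : D.P m →ₗ[A] A,
      f (Submodule.Quotient.mk h) = Submodule.Quotient.mk (h ∘ₗ φ) := by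
  obtain ⟨n, h, y, hy⟩ := exists_dualBasis (A := A) (Q := D.P m)
  choose e he using fun k => Submodule.Quotient.mk_surjective _ (f (Submodule.Quotient.mk (h k)))
  -- With `h`, `y` a dual basis of $P(m)$ and `e k` representing the image of `h k`, the candidate
  -- is $\varphi(x)=\sum_k e_k(x)y_k$. Right multiplication by $g(y_k)$ is the action of some
  -- $c_k\in B$, so $g=\sum_k c_kh_k$ while $g\circ\varphi=\sum_k c_ke_k$.
  refine ⟨∑ k, LinearMap.toSpanSingleton A _ (y k) ∘ₗ e k, fun g => ?_⟩
  choose c hc using fun k => hB (g (y k))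
  have hc' : ∀ k (a : A), c k • a = a * g (y k) := fun k a => by
    rw [← hc]
    exact (smul_one_mul _ _).symm
  have h1 : g = ∑ k, c k • h k := by
    ext x
    conv_lhs => rw [← hy x, map_sum]
    simp [LinearMap.sum_apply, hc']
  have h2 : g ∘ₗ ∑ k, LinearMap.toSpanSingleton A _ (y k) ∘ₗ e k = ∑ k, c k • e k := by
    ext x
    simp [LinearMap.sum_apply, hc']
  rw [h2]
  conv_lhs => rw [h1]
  simp only [← Submodule.mkQ_apply, map_sum, map_smul]
  exact Finset.sum_congr rfl fun k _ => congrArg (c k • ·) (he k).symm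

/-- The map is induced by some $P(l)\to P(m)$, and a composite $P(l)\to P(m)\to A$ has values in the
trace of $P(m)$, which is divided out when $m\not\le l$. -/
theorem opΔ_hom_eq_zero (hB : Function.Surjective fun b : B => b • (1 : A)) {m l : Λ}
    (hml : ¬ m ≤ l) (f : D.OpΔ B m →ₗ[B] D.OpΔ B l) : f = 0 := by
  obtain ⟨φ, hφ⟩ := exists_hom_opΔ_eq hB f
  refine LinearMap.ext fun h => ?_
  obtain ⟨h, rfl⟩ := Submodule.Quotient.mk_surjective _ h
  rw [hφ]
  exact (Submodule.Quotient.mk_eq_zero _).2 fun x => mem_trace (κ := m) hml h (φ x)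

theorem opΔ_end_bijective (hB : Function.Surjective fun b : B => b • (1 : A)) (l : Λ) :
    Function.Bijective (algebraMap R (Module.End B (D.OpΔ B l))) := by
  constructor
  · rw [injective_iff_map_eq_zero]
    intro r hr
    refine (injective_iff_map_eq_zero _).1 (D.end_bijective l).1 r (LinearMap.ext fun x => ?_)
    obtain ⟨x, rfl⟩ := D.π_surjective l x
    obtain ⟨n, h, y, hy⟩ := exists_dualBasis (A := A) (Q := D.P l)
    have h1 : ∀ k x, r • h k x ∈ D.trace {κ | ¬ κ ≤ l} A := fun k =>
      (Submodule.Quotient.mk_eq_zero (D.homTrace B {κ | ¬ κ ≤ l} l)).1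
        (LinearMap.congr_fun hr (Submodule.Quotient.mk (h k)))
    -- A scalar killing the new standard module moves $P(l)$ into its trace by the dual basis; that
    -- trace dies in $\Delta(l)$, so the scalar kills $\Delta(l)$ too.
    have h2 : r • x ∈ D.trace {κ | ¬ κ ≤ l} (D.P l) := by
      rw [← hy x, Finset.smul_sum]
      refine sum_mem fun k _ => ?_
      rw [← smul_assoc]
      exact map_mem_trace (LinearMap.toSpanSingleton A _ (y k)) (h1 k x)
    have h3 := map_mem_trace (D.π l) h2
    rw [trace_eq_bot (S := {κ | ¬ κ ≤ l})
      (isFree_of_inAdd (fun κ hκ => hκ) (InAdd.refl A (D.Δ l)))] at h3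
    rw [Module.algebraMap_end_apply, LinearMap.zero_apply,
      ← (D.π l).map_smul_of_tower, (Submodule.mem_bot A).1 h3]
  · intro f
    obtain ⟨φ, hφ⟩ := exists_hom_opΔ_eq hB f
    -- The lift `φ` induces an endomorphism of $\Delta(l)$, hence a scalar `r`. The difference of
    -- `r` and `φ` lands in the kernel of `D.π l`, which lies in the trace that is divided out.
    obtain ⟨g, hg⟩ := exists_factor_π (D := D) (fun μ hμ => D.hom_eq_zero μ l
      (not_le_of_gt hμ)) (D.π l ∘ₗ φ)
    obtain ⟨r, rfl⟩ := (D.end_bijective l).2 g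
    refine ⟨r, LinearMap.ext fun h => ?_⟩
    obtain ⟨h, rfl⟩ := Submodule.Quotient.mk_surjective _ h
    rw [hφ]
    refine (Submodule.Quotient.eq _).2 fun x => ?_
    have h1 : r • x - φ x ∈ D.trace {κ | ¬ κ ≤ l} (D.P l) :=
      ker_π_le_trace (Ioi_subset_not_le l) (by
        rw [map_sub, (D.π l).map_smul_of_tower]
        exact sub_eq_zero.2 (hg x))
    have h2 := map_mem_trace h h1
    rwa [map_sub, h.map_smul_of_tower] at h2

variable (B S T) in
/-- The subquotients of `A` by traces are bimodules. -/
noncomputable abbrev traceModule : Module B (SubQuot (D.trace S A) (D.trace T A)) where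
  smul b x := D.traceMap S T (actMap A b) x
  one_smul x := by
    obtain ⟨x, rfl⟩ := Submodule.Quotient.mk_surjective _ x
    exact congrArg Submodule.Quotient.mk (Subtype.ext (one_smul B (x : A)))
  mul_smul b c x := by
    obtain ⟨x, rfl⟩ := Submodule.Quotient.mk_surjective _ x
    exact congrArg Submodule.Quotient.mk (Subtype.ext (mul_smul b c (x : A)))
  smul_zero b := map_zero _
  smul_add b := map_add _
  add_smul b c x := by
    obtain ⟨x, rfl⟩ := Submodule.Quotient.mk_surjective _ x
    exact congrArg Submodule.Quotient.mk (Subtype.ext (add_smul b c (x : A)))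
  zero_smul x := by
    obtain ⟨x, rfl⟩ := Submodule.Quotient.mk_surjective _ x
    exact congrArg Submodule.Quotient.mk (Subtype.ext (zero_smul B (x : A)))

theorem inAdd_subQuot_homTrace [Finite Λ] {μ : Λ} (hS : IsUpperSet S) (hμ : μ ∉ S)
    (hT : IsUpperSet (insert μ S)) (l : Λ) :
    InAdd B (D.OpΔ B μ) (SubQuot (D.homTrace B S l) (D.homTrace B (insert μ S) l)) := by
  let N := SubQuot (D.trace S A) (D.trace (insert μ S) A)
  let _ : Module B N := D.traceModule B S (insert μ S)
  have : SMulCommClass A B N :=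
    ⟨fun a b x => (map_smul (D.traceMap S (insert μ S) (actMap A b)) a x).symm⟩
  have hN : InAdd A (D.Δ μ) N := inAdd_subQuot_trace D hS hμ hT
  let q : ∀ κ, D.homTrace B (insert μ S) κ →ₗ[B] (D.P κ →ₗ[A] N) := fun κ =>
    { toFun := fun f => ((D.trace S A).submoduleOf (D.trace (insert μ S) A)).mkQ ∘ₗ
        (f : D.P κ →ₗ[A] A).codRestrict _ f.2
      map_add' := fun f g => rfl
      map_smul' := fun b f => rfl }
  have hq : ∀ κ, Function.Surjective (q κ) := fun κ f => by
    obtain ⟨k, hk⟩ := exists_lift_subQuot f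
    exact ⟨⟨(D.trace (insert μ S) A).subtype ∘ₗ k, fun x => (k x).2⟩, LinearMap.ext hk⟩
  have hqk : ∀ κ f, q κ f = 0 ↔ (f : D.P κ →ₗ[A] A) ∈ D.homTrace B S κ := fun κ f => by
    rw [LinearMap.ext_iff]
    exact forall_congr' fun x => subQuot_mk_eq_zero
  let q' : (D.P μ →ₗ[A] A) →ₗ[B] (D.P μ →ₗ[A] N) :=
    q μ ∘ₗ LinearMap.id.codRestrict _ fun f => mem_trace (Set.mem_insert μ S) f
  have hq' : Function.Surjective q' := fun f => by
    obtain ⟨k, hk⟩ := hq μ f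
    exact ⟨k, hk⟩
  -- For maps from $P(\mu)$ the two traces impose the same condition: $P(\mu)$ maps to
  -- $\Delta(\kappa)$ only if $\mu\le\kappa$, and such a $\kappa\not\le\mu$ lies in $S$ because
  -- `insert μ S` is an upper set.
  have hq'k : LinearMap.ker q' = D.homTrace B {κ | ¬ κ ≤ μ} μ := by
    ext f
    refine (hqk μ _).trans ⟨fun hf x => ?_, fun hf => ?_⟩
    · exact trace_mono (fun κ hκ hle => hμ (hS hle hκ)) (hf x)
    · refine mem_trace_of_mem_trace hS (isUpperSet_not_le μ)
        (fun κ hκ hle => hμ (hS hle hκ)) (fun κ hκ hκS => hom_P_Δ_eq_zero fun hle => ?_) f hf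
      rcases hT hle (Set.mem_insert μ S) with h | h
      · exact hκ h.le
      · exact hκS h
  let e : D.OpΔ B μ ≃ₗ[B] (D.P μ →ₗ[A] N) :=
    (Submodule.quotEquivOfEq _ _ hq'k.symm).trans (q'.quotKerEquivOfSurjective hq')
  -- Maps from $P(\mu)$ to $N\in\operatorname{add}\Delta(\mu)$ factor through $\Delta(\mu)$, so the
  -- new standard module is $\operatorname{Hom}_A(\Delta(\mu),N)$.
  let e' : (D.Δ μ →ₗ[A] N) ≃ₗ[B] (D.P μ →ₗ[A] N) :=
    LinearEquiv.ofBijective (precomp B N (D.π μ)) ⟨fun f g h => LinearMap.ext fun x => by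
        obtain ⟨x, rfl⟩ := D.π_surjective μ x
        exact LinearMap.congr_fun h x,
      fun f => by
        obtain ⟨g, hg⟩ := exists_factor_π (D := D) (fun κ hκ => hN.hom_eq_zero'
          (D.hom_eq_zero κ μ (not_le_of_gt hκ))) f
        exact ⟨g, LinearMap.ext hg⟩⟩
  have hfin : InAdd R (D.Δ μ) (D.P l →ₗ[A] D.Δ μ) := inAdd_hom_of_projective
  have := hfin.finite
  have := hfin.projective
  have h1 : InAdd B (D.Δ μ →ₗ[A] N) (D.P l →ₗ[A] N) := inAdd_hom (D.end_bijective μ).2 hN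
  exact ((((InAdd.refl B _).of_equiv (e'.trans e.symm)).trans h1).of_equiv
    (subQuotEquiv (q l) (hq l) (hqk l)))

theorem filt_ker_opΔ [Finite Λ] (l : Λ) : Filt B (D.OpΔ B) (Set.Ioi l)
    (LinearMap.ker (D.homTrace B {κ | ¬ κ ≤ l} l).mkQ) := by
  have h0 : D.homTrace B ∅ l = ⊥ := eq_bot_iff.2 fun f hf => LinearMap.ext fun x => by
    have := hf x
    rwa [trace_empty] at this
  -- Since $P(l)$ maps nontrivially to $\Delta(\kappa)$ only for $l\le\kappa$, the trace of
  -- $\{\kappa\not\le l\}$ can be replaced by that of $\{\kappa>l\}$. This confines the factors to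
  -- indices above $l$.
  have h1 : D.homTrace B (Set.Ioi l) l = D.homTrace B {κ | ¬ κ ≤ l} l := by
    ext f
    refine ⟨fun hf x => trace_mono (Ioi_subset_not_le l) (hf x), fun hf => ?_⟩
    exact mem_trace_of_mem_trace (isUpperSet_Ioi l) (isUpperSet_not_le l) (Ioi_subset_not_le l)
      (fun κ hκ hκ' => hom_P_Δ_eq_zero fun hle => hκ' (lt_of_le_not_ge hle hκ)) f hf
  refine Filt.of_chain ?_
  rw [Submodule.ker_mkQ, ← h1, ← h0]
  refine upperSet_induction isUpperSet_empty (isUpperSet_Ioi l) (Set.empty_subset _)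
    (Q := fun V => Relation.ReflTransGen (FiltStep (D.OpΔ B) (Set.Ioi l)) (D.homTrace B ∅ l)
      (D.homTrace B V l)) .refl fun V μ _ hV hμ hT hle ih => ?_
  exact ih.tail ⟨fun f hf x => trace_mono (Set.subset_insert _ _) (hf x), μ,
    hle (Set.mem_insert _ _), D.inAdd_subQuot_homTrace hV hμ hT l⟩

/-- The opposite regular module is generated by the modules `Hom(P l, A)`. -/
theorem inAddFamily_opposite (hB : Function.Bijective fun b : B => b • (1 : A)) :
    InAddFamily B (fun l => D.P l →ₗ[A] A) B := by
  have h : InAddFamily B (fun l => D.P l →ₗ[A] A) A := by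
    obtain ⟨n, l, i, p, h⟩ := D.generates
    refine ⟨n, l, fun k => smulRightHom B A (p k), fun k => evalHom A B A (i k 1), fun x => ?_⟩
    change ∑ k, p k (i k 1) • x = x
    rw [← Finset.sum_smul, h, one_smul]
  exact h.of_equiv (LinearEquiv.ofBijective (LinearMap.toSpanSingleton B A 1) hB)

theorem inAdd_self_opposite (hB : Function.Bijective fun b : B => b • (1 : A)) (l : Λ) :
    InAdd B B (D.P l →ₗ[A] A) :=
  ((InAdd.refl B B).of_equiv
    (LinearEquiv.ofBijective (LinearMap.toSpanSingleton B A 1) hB).symm).trans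
    inAdd_hom_of_projective

include D in
/-- A split quasi-hereditary structure on an algebra induces one on the opposite algebra. -/
theorem nonempty_opposite [Module.Finite R A] [Finite Λ]
    (hB : Function.Bijective fun b : B => b • (1 : A)) : Nonempty (StdSystem R B Λ) :=
  ⟨{Δ := D.OpΔ B
    finiteΔ := fun l => (D.finite_projective_opΔ l).1
    projΔ := fun l => (D.finite_projective_opΔ l).2
    P := fun l => D.P l →ₗ[A] A
    finiteP := fun l => (D.inAdd_self_opposite hB l).finite
    projP := fun l => (D.inAdd_self_opposite hB l).projective
    hom_eq_zero := fun l m h => D.opΔ_hom_eq_zero hB.2 h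
    end_bijective := by exact D.opΔ_end_bijective hB.2
    π := fun l => (D.homTrace B {κ | ¬ κ ≤ l} l).mkQ
    π_surjective := fun l => (D.homTrace B {κ | ¬ κ ≤ l} l).mkQ_surjective
    filt_ker := by exact D.filt_ker_opΔ
    generates := D.inAddFamily_opposite hB }⟩

end StdSystem

/-! ### Conclusion. -/

section Opposite

variable (R : Type u) [CommRing R] (A : Type v) [Ring A] [Algebra R A]

theorem bijective_op_smul_one : Function.Bijective fun b : Aᵐᵒᵖ => b • (1 : A) := by
  have : (fun b : Aᵐᵒᵖ => b • (1 : A)) = MulOpposite.unop := by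
    ext b
    exact one_mul b.unop
  rw [this]
  exact MulOpposite.unop_bijective

theorem bijective_smul_op_one : Function.Bijective fun a : A => a • (1 : Aᵐᵒᵖ) := by
  have : (fun a : A => a • (1 : Aᵐᵒᵖ)) = MulOpposite.op := by
    ext a
    exact MulOpposite.unop_injective (mul_one a)
  rw [this]
  exact MulOpposite.op_bijective

instance : SMulCommClass Aᵐᵒᵖ A Aᵐᵒᵖ :=
  ⟨fun b a x => MulOpposite.unop_injective (mul_assoc a x.unop b.unop)⟩

/-- Each direction passes through $A^{op}$: one of the two changes of side is the symmetry of
standard systems, the other is $R$-duality. -/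
theorem nonempty_stdSystem_iff_nonempty_costdSystem [Module.Finite R A] [Module.Projective R A]
    (Λ : Type w) [PartialOrder Λ] [Finite Λ] :
    Nonempty (StdSystem R A Λ) ↔ Nonempty (CostdSystem R A Λ) := by
  have hf : Module.Finite R Aᵐᵒᵖ := Module.Finite.equiv (MulOpposite.opLinearEquiv R)
  have hp : Module.Projective R Aᵐᵒᵖ := Module.Projective.of_equiv (MulOpposite.opLinearEquiv R)
  constructor
  · rintro ⟨D⟩
    obtain ⟨E⟩ := D.nonempty_opposite (bijective_op_smul_one A)
    exact E.nonempty_costdSystem (bijective_smul_op_one A)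
  · rintro ⟨D⟩
    obtain ⟨E⟩ := D.nonempty_stdSystem (bijective_op_smul_one A)
    exact E.nonempty_opposite (bijective_smul_op_one A)

end Opposite

end SplitQH

theorem mainTheorem9 (R : Type u) [CommRing R] [IsNoetherianRing R]
    (A : Type v) [Ring A] [Algebra R A] [Module.Finite R A] [Module.Projective R A]
    (Λ : Type w) [PartialOrder Λ] [Finite Λ] :
    (∃ (Δ : Λ → Type (max u v)) (_ : ∀ l, AddCommGroup (Δ l)) (_ : ∀ l, Module R (Δ l))
        (_ : ∀ l, Module A (Δ l)) (_ : ∀ l, IsScalarTower R A (Δ l)),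
        SplitQH.IsSplitQuasiHereditary R A Δ) ↔
    (∃ (N : Λ → Type (max u v)) (_ : ∀ l, AddCommGroup (N l)) (_ : ∀ l, Module R (N l))
        (_ : ∀ l, Module A (N l)) (_ : ∀ l, IsScalarTower R A (N l)),
        (∀ l, Module.Finite A (N l) ∧ Module.Projective R (N l)) ∧
        (∀ a b, (∃ f : N a →ₗ[A] N b, f ≠ 0) → a ≥ b) ∧
        (∀ l, Nonempty (Module.End A (N l) ≃ₐ[R] R)) ∧
        ∃ (I : Λ → Type (max u v)) (_ : ∀ l, AddCommGroup (I l)) (_ : ∀ l, Module R (I l))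
          (_ : ∀ l, Module A (I l)) (_ : ∀ l, IsScalarTower R A (I l)),
          (∀ l, SplitQH.IsRelInjective R A (I l) ∧
            ∃ ι : N l →ₗ[A] I l, Function.Injective ι ∧
              SplitQH.HasFiltration R A N (Set.Ioi l) (I l ⧸ LinearMap.range ι)) ∧
          SplitQH.InAdd A (⨁ l, I l) (SplitQH.RegularDual R A)) := by
  rw [SplitQH.exists_isSplitQuasiHereditary_iff,
    SplitQH.nonempty_stdSystem_iff_nonempty_costdSystem, SplitQH.nonempty_costdSystem_iff]
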